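/- **Theorem 3.1.** Let $S=\mathbb{C}[x_1,x_2,x_3,x_4]$ and, for positive integers $a<b$, set $p_a=x_1^a+x_2^a+x_3^a+x_4^a$ and $p_b=x_1^b+x_2^b+x_3^b+x_4^b$. For a prime $p$ and a nonzero integer $n$, let $\nu_p(n)$ denote the largest integer $e$ such that $p^e$ divides $n$. A normal domain is an integral domain that is integrally closed in its field of fractions. If $a=1$, then $S/(p_a,p_b)$ is a normal domain if and only if $b$ is even. If $1<a<b$, then $S/(p_a,p_b)$ is a normal domain if and only if 1. $\nu_2(a)\neq\nu_2(b)$, and 2. either $\nu_3(a)\neq\nu_3(b)$, or $\nu_3(a)=\nu_3(b)=\nu_3(a-b)$. -/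

import Mathlib

/-- A normal domain: an integral domain that is integrally closed in its field of fractions. -/
def IsNormalDomain (R : Type*) [CommRing R] : Prop :=
  IsDomain R ∧ IsIntegrallyClosed R

/-- The ideal `(p_a, p_b)` of `ℂ[x₁, x₂, x₃, x₄]`, where `p_k = x₁ ^ k + x₂ ^ k + x₃ ^ k + x₄ ^ k`. -/
noncomputable def powerSumIdeal (a b : ℕ) : Ideal (MvPolynomial (Fin 4) ℂ) :=
  Ideal.span {MvPolynomial.psum (Fin 4) ℂ a, MvPolynomial.psum (Fin 4) ℂ b}

/-! Write `R` for the quotient ring. The positive direction is Serre's criterion done by hand. Where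
a 2×2 Jacobian minor `J` is inverted, `R` is étale over a polynomial ring in the two remaining
variables (`PowerSumRing.etale_away_minor`). Hence `R[1/J]` is integrally closed in its generic
fibre, a reduced Artinian ring. If ν₂(a) ≠ ν₂(b), every such minor is a nonzerodivisor, so `R`
embeds in that fibre and is reduced. Moreover `x₀, x₁` is a regular sequence
(`PowerSumRing.exists_eq_x_mul_of_x_mul_eq`).

At a common zero of `p_a` and all minors, dividing by a nonzero coordinate gives a vanishing sum of
four numbers `z ^ a`, each `z` being zero or satisfying `z ^ (b - a) = 1`. Such a sum forces some `z
^ a` to be -1 or a primitive cube root of unity. The first is excluded by ν₂(a) ≠ ν₂(b), the second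
by ν₃(b - a) ≤ ν₃(a), which is condition 2 restated. For `a = 1` no coordinate can vanish, so cube
roots never arise. Thus only the origin is singular, and by the Nullstellensatz an ideal containing
powers of all minors contains powers of all `x_k`. Applied to the denominators of an integral
fraction, this and the regular sequence put the fraction in `R`. The same argument puts in `R` any
idempotent fraction that would split it; the grading leaves only the idempotents 0 and 1, so `R` is
a domain.

Conversely, if ν₂(a) = ν₂(b), odd-power factorizations yield explicit zero divisors. If condition 2
fails and `a > 1`, there are singular points over `(1, ω, ω², 0)`. Near them Newton's identities
give a relation `α f² + γ g² = 0` with `α` invertible, so `α f / g` is integral but not in `R`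
(`not_isNormalDomain_of_quadratic_relation`). -/

open TensorProduct

/-! ### Generic fibres of étale algebras and integral closure -/

theorem exists_sq_mul_eq_self {T : Type*} [CommRing T] [IsArtinianRing T] [IsReduced T] (x : T) :
    ∃ c, x ^ 2 * c = x := by
  obtain ⟨n, c, hc⟩ := IsArtinian.exists_pow_succ_smul_dvd (R := T) (M := T) x 1
  simp only [smul_eq_mul, mul_one] at hc
  refine ⟨c, ?_⟩
  -- The descending chain of powers of `x` stabilizes, so the defect `x (1 - x c)` is nilpotent. The
  -- resulting `x * c` is an idempotent with the same annihilator as `x`.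
  have h : (x - x ^ 2 * c) ^ (n + 1) = 0 := by
    have : x - x ^ 2 * c = x * (1 - x * c) := by ring
    rw [this, mul_pow, pow_succ (1 - x * c)]
    have h2 : x ^ (n + 1) * ((1 - x * c) ^ n * (1 - x * c)) =
        x * (1 - x * c) ^ n * (x ^ n - x ^ (n + 1) * c) := by ring
    rw [h2]
    have : x ^ (n + 1) * c = x ^ n := by simpa [Nat.succ_eq_add_one] using hc
    rw [this]; ring
  have := pow_eq_zero_iff (n.succ_ne_zero) |>.mp h
  exact (sub_eq_zero.mp this).symm

section

variable (A B : Type*) [CommRing A] [CommRing B] [Algebra A B] [Algebra.Etale A B]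

theorem isArtinianRing_tensorProduct_fractionRing [IsDomain A] : IsArtinianRing (B ⊗[A] FractionRing A) := by
  have : Module.Finite (FractionRing A) (FractionRing A ⊗[A] B) :=
    Algebra.FormallyUnramified.finite_of_free _ _
  have : IsArtinianRing (FractionRing A ⊗[A] B) := IsArtinianRing.of_finite (FractionRing A) _
  exact (Algebra.TensorProduct.comm A (FractionRing A) B).toRingEquiv.surjective.isArtinianRing

theorem isReduced_tensorProduct_fractionRing [IsDomain A] : IsReduced (B ⊗[A] FractionRing A) := by
  have : IsReduced (FractionRing A ⊗[A] B) :=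
    Algebra.FormallyUnramified.isReduced_of_field (FractionRing A) _
  exact isReduced_of_injective (Algebra.TensorProduct.comm A B (FractionRing A))
    (Algebra.TensorProduct.comm A B (FractionRing A)).injective

theorem injective_algebraMap_tensorProduct_fractionRing :
    Function.Injective (algebraMap B (B ⊗[A] FractionRing A)) :=
  Algebra.TensorProduct.includeLeft_injective (S := B) (IsFractionRing.injective A (FractionRing A))

/-- Integral closure commutes with smooth base change, and `A` is its own integral closure in its
fraction field. -/
theorem exists_algebraMap_eq_of_isIntegral_tensorProduct_fractionRing [IsDomain A]
    [IsIntegrallyClosed A]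
    {t : B ⊗[A] FractionRing A} (ht : IsIntegral B t) : ∃ y : B, algebraMap B _ y = t := by
  obtain ⟨z, hz⟩ := (TensorProduct.toIntegralClosure_bijective_of_smooth
    (R := A) (S := B) (B := FractionRing A)).2 ⟨t, ht⟩
  have key : ∀ z : B ⊗[A] integralClosure A (FractionRing A),
      ∃ y : B, algebraMap B (B ⊗[A] FractionRing A) y =
        (TensorProduct.toIntegralClosure A B (FractionRing A) z : B ⊗[A] FractionRing A) := by
    intro z
    induction z with
    | zero => exact ⟨0, by simp⟩
    | add x y hx hy =>
      obtain ⟨x', hx⟩ := hx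
      obtain ⟨y', hy⟩ := hy
      exact ⟨x' + y', by rw [map_add, map_add, hx, hy]; rfl⟩
    | tmul x y =>
      obtain ⟨y, hy⟩ := y
      have hy' := hy
      rw [IsIntegrallyClosed.integralClosure_eq_bot, Algebra.mem_bot] at hy'
      obtain ⟨a, rfl⟩ := hy'
      refine ⟨a • x, ?_⟩
      simp only [TensorProduct.toIntegralClosure, AlgHom.coe_codRestrict,
        Algebra.TensorProduct.map_tmul, AlgHom.coe_id, id_eq, Subalgebra.coe_val,
        Algebra.algebraMap_eq_smul_one (R := A) (A := FractionRing A),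
        Algebra.TensorProduct.algebraMap_apply, Algebra.algebraMap_self, RingHom.id_apply,
        TensorProduct.smul_tmul]
  obtain ⟨y, hy⟩ := key z
  exact ⟨y, by rw [hy, hz]⟩

end

theorem injective_toLocalizationAway {R : Type*} [CommRing R] {J : R}
    (hJ : ∀ r : R, J * r = 0 → r = 0) :
    Function.Injective (algebraMap R (Localization.Away J)) := by
  refine IsLocalization.injective _ (M := Submonoid.powers J) ?_
  rw [Submonoid.powers_le]
  exact mem_nonZeroDivisors_iff.mpr ⟨hJ, fun r h => hJ r (by rw [mul_comm]; exact h)⟩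

section

variable (A : Type*) {R : Type*} [CommRing A] [CommRing R] [Algebra A R]

/-- The canonical map from `R` to the generic fibre of `R[1/J]` over `A`. -/
noncomputable def toGenericFibre (J : R) : R →+* Localization.Away J ⊗[A] FractionRing A :=
  (algebraMap (Localization.Away J) _).comp (algebraMap R _)

variable {J : R} [Algebra.Etale A (Localization.Away J)]

theorem injective_toGenericFibre (hJ : ∀ r : R, J * r = 0 → r = 0) :
    Function.Injective (toGenericFibre A J) :=
  (injective_algebraMap_tensorProduct_fractionRing A (Localization.Away J)).comp
    (injective_toLocalizationAway hJ)

theorem isReduced_of_etale_away [IsDomain A] (hJ : ∀ r : R, J * r = 0 → r = 0) : IsReduced R :=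
  have := isReduced_tensorProduct_fractionRing A (Localization.Away J)
  isReduced_of_injective (toGenericFibre A J) (injective_toGenericFibre A hJ)

variable [IsDomain A] [IsIntegrallyClosed A]

theorem exists_toGenericFibre_eq_pow_mul_of_isIntegral
    {t : Localization.Away J ⊗[A] FractionRing A} (ht : IsIntegral (Localization.Away J) t) :
    ∃ (N : ℕ) (y : R), toGenericFibre A J y = toGenericFibre A J J ^ N * t := by
  obtain ⟨z, rfl⟩ := exists_algebraMap_eq_of_isIntegral_tensorProduct_fractionRing A _ ht
  obtain ⟨N, y, hy⟩ := IsLocalization.Away.surj J z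
  exact ⟨N, y, by rw [toGenericFibre, RingHom.comp_apply, ← hy]; simp [mul_comm]⟩

end

/-- In the generic fibre, `f` generates the same ideal as an idempotent `e`. Being a root of `X² -
X`, `e` is integral, so it lies in `R[1/J]`; take `y = J ^ N * e`. -/
theorem exists_idempotent_fraction_of_etale_away (A : Type*) {R : Type*} [CommRing A] [IsDomain A]
    [IsIntegrallyClosed A] [CommRing R] [Algebra A R] {J : R}
    [Algebra.Etale A (Localization.Away J)]
    (hJ : ∀ r : R, J * r = 0 → r = 0) (f : R) :
    ∃ (N : ℕ) (y : R), y * f = J ^ N * f ∧ ∀ z, z * f = 0 → y * z = 0 := by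
  have := isReduced_tensorProduct_fractionRing A (Localization.Away J)
  have := isArtinianRing_tensorProduct_fractionRing A (Localization.Away J)
  have inj := injective_toGenericFibre A hJ
  set φ := toGenericFibre A J with hφ
  obtain ⟨c, hc⟩ := exists_sq_mul_eq_self (φ f)
  have he : IsIntegral (Localization.Away J) (φ f * c) := by
    refine ⟨Polynomial.X ^ 2 - Polynomial.X, Polynomial.monic_X_pow_sub
        (Polynomial.degree_X_le.trans_lt (by norm_num)), ?_⟩
    simp only [Polynomial.eval₂_sub, Polynomial.eval₂_pow, Polynomial.eval₂_X]
    linear_combination c * hc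
  obtain ⟨N, y, hy⟩ := exists_toGenericFibre_eq_pow_mul_of_isIntegral A he
  refine ⟨N, y, inj ?_, fun z hz => inj ?_⟩
  · simp only [map_mul, map_pow, ← hφ] at hy ⊢
    linear_combination φ f * hy + φ J ^ N * hc
  · have hz' : φ z * φ f = 0 := by rw [← map_mul, hz, map_zero]
    simp only [map_mul, ← hφ, map_zero] at hy ⊢
    linear_combination φ z * hy + φ J ^ N * c * hz'

theorem exists_pow_mul_eq_of_isIntegral_of_etale_away (A : Type*) {R : Type*} [CommRing A] [IsDomain A]
    [IsIntegrallyClosed A] [CommRing R] [Algebra A R] {J : R}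
    [Algebra.Etale A (Localization.Away J)]
    [IsDomain R] (hJ : J ≠ 0) {p q : R}
    (hq : q ≠ 0) (hpq : IsIntegral R (algebraMap R (FractionRing R) p / algebraMap R _ q)) :
    ∃ (N : ℕ) (y : R), J ^ N * p = q * y := by
  have hJ' : ∀ r : R, J * r = 0 → r = 0 := fun r h => (mul_eq_zero.mp h).resolve_left hJ
  have := isReduced_tensorProduct_fractionRing A (Localization.Away J)
  have := isArtinianRing_tensorProduct_fractionRing A (Localization.Away J)
  have inj := injective_toGenericFibre A hJ'
  -- The complementary idempotent `1 - q c` is integral, so it comes from `R` after multiplication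
  -- by a power of `J`. It is killed by `q`, hence vanishes because `R` is a domain. So the whole
  -- fraction field of `R` maps to the generic fibre.
  have hunit : ∀ q : R, q ≠ 0 → IsUnit (toGenericFibre A J q) := by
    intro q hq
    obtain ⟨c, hc⟩ := exists_sq_mul_eq_self (toGenericFibre A J q)
    have he : IsIntegral (Localization.Away J) (1 - toGenericFibre A J q * c) := by
      refine ⟨Polynomial.X ^ 2 - Polynomial.X, Polynomial.monic_X_pow_sub
        (Polynomial.degree_X_le.trans_lt (by norm_num)), ?_⟩
      simp only [Polynomial.eval₂_sub, Polynomial.eval₂_pow, Polynomial.eval₂_X]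
      linear_combination c * hc
    obtain ⟨N, y, hy⟩ := exists_toGenericFibre_eq_pow_mul_of_isIntegral A he
    have hqy : q * y = 0 := by
      apply inj
      rw [map_mul, hy, map_zero]
      linear_combination - toGenericFibre A J J ^ N * hc
    rw [(mul_eq_zero.mp hqy).resolve_left hq, map_zero, ← map_pow] at hy
    have hJN : IsUnit (toGenericFibre A J (J ^ N)) := by
      rw [map_pow]
      refine IsUnit.pow _ ?_
      exact (IsLocalization.Away.algebraMap_isUnit (S := Localization.Away J) J).map
        (algebraMap (Localization.Away J) (Localization.Away J ⊗[A] FractionRing A))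
    have := (hJN.mul_right_eq_zero).mp hy.symm
    exact IsUnit.of_mul_eq_one c (sub_eq_zero.mp this).symm
  let ψ : FractionRing R →+* Localization.Away J ⊗[A] FractionRing A :=
    IsLocalization.lift (M := nonZeroDivisors R) (g := toGenericFibre A J)
      fun s => hunit s (nonZeroDivisors.ne_zero s.2)
  have hψ : ∀ r, ψ (algebraMap R _ r) = toGenericFibre A J r := fun r =>
    IsLocalization.lift_eq _ r
  have hint : IsIntegral (Localization.Away J)
      (ψ (algebraMap R (FractionRing R) p / algebraMap R _ q)) := by
    obtain ⟨P, hP, hP0⟩ := hpq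
    refine ⟨P.map (algebraMap R _), hP.map _, ?_⟩
    rw [Polynomial.eval₂_map]
    have h2 := congrArg ψ hP0
    rw [Polynomial.hom_eval₂, map_zero] at h2
    rw [← h2]
    congr 1
    ext r
    exact (hψ r).symm
  obtain ⟨N, y, hy⟩ := exists_toGenericFibre_eq_pow_mul_of_isIntegral A hint
  refine ⟨N, y, inj ?_⟩
  rw [map_mul, map_mul, map_pow, hy, mul_left_comm, ← hψ q, ← map_mul,
    mul_div_cancel₀ _ (by simpa using hq), hψ]

/-! ### Newton's method modulo a square-zero ideal -/

section Newton

variable {C : Type*} [CommRing C]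

theorem add_pow_succ_of_mul_self_eq_zero (x δ : C) (hδ : δ * δ = 0) (n : ℕ) :
    (x + δ) ^ (n + 1) = x ^ (n + 1) + (n + 1 : ℕ) * x ^ n * δ := by
  induction n with
  | zero => simp
  | succ n ih =>
    rw [pow_succ, ih]
    push_cast
    linear_combination (n + 1 : C) * x ^ n * hδ

theorem add_pow_of_mul_self_eq_zero (x δ : C) (hδ : δ * δ = 0) {n : ℕ} (hn : 0 < n) :
    (x + δ) ^ n = x ^ n + n * x ^ (n - 1) * δ := by
  obtain ⟨n, rfl⟩ := Nat.exists_eq_succ_of_ne_zero hn.ne'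
  exact add_pow_succ_of_mul_self_eq_zero x δ hδ n

variable {I : Ideal C} (hI : ∀ x ∈ I, ∀ y ∈ I, x * y = 0) {a b : ℕ} (ha : 0 < a) (hb : 0 < b)
  (ua : IsUnit (a : C)) (ub : IsUnit (b : C)) {x y s t : C}
  (hD : IsUnit (x ^ (a - 1) * y ^ (b - 1) - x ^ (b - 1) * y ^ (a - 1)))
include hI ha hb ua ub hD

theorem exists_newton_step (hs : x ^ a + y ^ a + s ∈ I) (ht : x ^ b + y ^ b + t ∈ I) :
    ∃ δ ∈ I, ∃ ε ∈ I, (x + δ) ^ a + (y + ε) ^ a + s = 0 ∧ (x + δ) ^ b + (y + ε) ^ b + t = 0 := by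
  obtain ⟨D, hD⟩ := hD.exists_right_inv
  obtain ⟨a', ha'⟩ := ua.exists_right_inv
  obtain ⟨b', hb'⟩ := ub.exists_right_inv
  set F := x ^ a + y ^ a + s
  set G := x ^ b + y ^ b + t
  -- Since `I` squares to zero, the equations are linear in the corrections; these are the two
  -- entries of the solution by Cramer's rule.
  have hδ : D * (y ^ (a - 1) * b' * G - y ^ (b - 1) * a' * F) ∈ I :=
    I.mul_mem_left _ (I.sub_mem (I.mul_mem_left _ ht) (I.mul_mem_left _ hs))
  have hε : D * (x ^ (b - 1) * a' * F - x ^ (a - 1) * b' * G) ∈ I :=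
    I.mul_mem_left _ (I.sub_mem (I.mul_mem_left _ hs) (I.mul_mem_left _ ht))
  refine ⟨_, hδ, _, hε, ?_, ?_⟩
  · rw [add_pow_of_mul_self_eq_zero _ _ (hI _ hδ _ hδ) ha,
      add_pow_of_mul_self_eq_zero _ _ (hI _ hε _ hε) ha]
    linear_combination (-F * (a * a')) * hD - F * ha'
  · rw [add_pow_of_mul_self_eq_zero _ _ (hI _ hδ _ hδ) hb,
      add_pow_of_mul_self_eq_zero _ _ (hI _ hε _ hε) hb]
    linear_combination (-G * (b * b')) * hD - G * hb'

theorem newton_step_unique {x' y' : C} (hx : x' - x ∈ I) (hy : y' - y ∈ I)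
    (hs : x' ^ a + y' ^ a = x ^ a + y ^ a) (ht : x' ^ b + y' ^ b = x ^ b + y ^ b) :
    x' = x ∧ y' = y := by
  obtain ⟨D, hD⟩ := hD.exists_right_inv
  obtain ⟨a', ha'⟩ := ua.exists_right_inv
  obtain ⟨b', hb'⟩ := ub.exists_right_inv
  obtain ⟨δ, rfl⟩ : ∃ δ, x' = x + δ := ⟨x' - x, by ring⟩
  obtain ⟨ε, rfl⟩ : ∃ ε, y' = y + ε := ⟨y' - y, by ring⟩
  rw [add_sub_cancel_left] at hx hy
  rw [add_pow_of_mul_self_eq_zero _ _ (hI _ hx _ hx) ha,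
      add_pow_of_mul_self_eq_zero _ _ (hI _ hy _ hy) ha] at hs
  rw [add_pow_of_mul_self_eq_zero _ _ (hI _ hx _ hx) hb,
      add_pow_of_mul_self_eq_zero _ _ (hI _ hy _ hy) hb] at ht
  have h1 : x ^ (a - 1) * δ + y ^ (a - 1) * ε = 0 := by
    linear_combination a' * hs - (x ^ (a - 1) * δ + y ^ (a - 1) * ε) * ha'
  have h2 : x ^ (b - 1) * δ + y ^ (b - 1) * ε = 0 := by
    linear_combination b' * ht - (x ^ (b - 1) * δ + y ^ (b - 1) * ε) * hb'
  have h3 : δ = 0 := by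
    linear_combination D * (y ^ (b - 1) * h1 - y ^ (a - 1) * h2) - δ * hD
  have h4 : ε = 0 := by
    linear_combination D * (x ^ (a - 1) * h2 - x ^ (b - 1) * h1) - ε * hD
  simp [h3, h4]

end Newton

/-! ### The power sum ring and the Jacobian criterion -/

/-- The ring `ℂ[x₁, x₂, x₃, x₄] / (p_a, p_b)`. -/
abbrev PowerSumRing (a b : ℕ) : Type := MvPolynomial (Fin 4) ℂ ⧸ powerSumIdeal a b

namespace PowerSumRing

variable {a b : ℕ}

/-- The class of the `i`-th variable. -/
noncomputable def x (a b : ℕ) (i : Fin 4) : PowerSumRing a b :=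
  Ideal.Quotient.mk _ (MvPolynomial.X i)

/-- The Jacobian minor of `p_a`, `p_b` in the variables `i`, `j`, up to the factor `a * b`. -/
noncomputable def minor (a b : ℕ) (i j : Fin 4) : PowerSumRing a b :=
  x a b i ^ (a - 1) * x a b j ^ (b - 1) - x a b i ^ (b - 1) * x a b j ^ (a - 1)

theorem mk_psum_left : Ideal.Quotient.mk (powerSumIdeal a b) (MvPolynomial.psum (Fin 4) ℂ a) = 0 :=
  Ideal.Quotient.eq_zero_iff_mem.mpr (Ideal.subset_span (by simp))

theorem mk_psum_right : Ideal.Quotient.mk (powerSumIdeal a b) (MvPolynomial.psum (Fin 4) ℂ b) = 0 :=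
  Ideal.Quotient.eq_zero_iff_mem.mpr (Ideal.subset_span (by simp))

theorem sum_x_pow_left : ∑ i, x a b i ^ a = 0 := by
  rw [← mk_psum_left (a := a) (b := b)]
  simp [MvPolynomial.psum, x]

theorem sum_x_pow_right : ∑ i, x a b i ^ b = 0 := by
  rw [← mk_psum_right (a := a) (b := b)]
  simp [MvPolynomial.psum, x]

/-- The homomorphism out of `PowerSumRing a b` given by a common zero of the two power sums. -/
noncomputable def lift {C : Type*} [CommRing C] (f : ℂ →+* C) (v : Fin 4 → C)
    (hva : ∑ i, v i ^ a = 0) (hvb : ∑ i, v i ^ b = 0) : PowerSumRing a b →+* C :=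
  Ideal.Quotient.lift _ (MvPolynomial.eval₂Hom f v) <| by
    have : powerSumIdeal a b ≤ RingHom.ker (MvPolynomial.eval₂Hom f v) := by
      rw [powerSumIdeal, Ideal.span_le]
      rintro p (rfl | rfl)
      · simpa [RingHom.mem_ker, MvPolynomial.psum] using hva
      · simpa [RingHom.mem_ker, MvPolynomial.psum] using hvb
    exact fun p hp => this hp

section

variable {C : Type*} [CommRing C] (f : ℂ →+* C) (v : Fin 4 → C)
  (hva : ∑ i, v i ^ a = 0) (hvb : ∑ i, v i ^ b = 0)

@[simp]
theorem lift_mk (p : MvPolynomial (Fin 4) ℂ) :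
    lift f v hva hvb (Ideal.Quotient.mk _ p) = MvPolynomial.eval₂ f v p := rfl

@[simp]
theorem lift_x (i : Fin 4) : lift f v hva hvb (x a b i) = v i := by
  simp [x]

@[simp]
theorem lift_algebraMap (c : ℂ) :
    lift f v hva hvb (algebraMap ℂ (PowerSumRing a b) c) = f c := by
  change lift f v hva hvb (Ideal.Quotient.mk _ (MvPolynomial.C c)) = _
  simp

theorem ringHom_ext {g h : PowerSumRing a b →+* C}
    (hC : ∀ c : ℂ, g (algebraMap ℂ _ c) = h (algebraMap ℂ _ c))
    (hx : ∀ i, g (x a b i) = h (x a b i)) : g = h := by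
  apply Ideal.Quotient.ringHom_ext
  apply MvPolynomial.ringHom_ext
  · exact hC
  · exact hx

end

theorem sum_perm {M : Type*} [AddCommMonoid M] (e : Equiv.Perm (Fin 4)) (f : Fin 4 → M) :
    ∑ i, f i = f (e 0) + f (e 1) + f (e 2) + f (e 3) := by
  rw [← Equiv.sum_comp e, Fin.sum_univ_four]

theorem forall_perm (e : Equiv.Perm (Fin 4)) {P : Fin 4 → Prop} (h0 : P (e 0)) (h1 : P (e 1))
    (h2 : P (e 2)) (h3 : P (e 3)) (i : Fin 4) : P i := by
  obtain ⟨j, rfl⟩ := e.surjective i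
  fin_cases j <;> assumption

/-- The map from the polynomial ring in two variables given by the last two of the variables
permuted by `e`. -/
noncomputable def baseMap (a b : ℕ) (e : Equiv.Perm (Fin 4)) :
    MvPolynomial (Fin 2) ℂ →ₐ[ℂ] PowerSumRing a b :=
  MvPolynomial.aeval ![x a b (e 2), x a b (e 3)]

/-- Infinitesimal lifting: the images of `x (e 2)` and `x (e 3)` are prescribed by the base, and
those of `x (e 0)` and `x (e 1)` lift uniquely by a Newton step because the minor is a unit. -/
theorem formallyEtale_away_minor (ha : 0 < a) (hb : 0 < b) (e : Equiv.Perm (Fin 4)) :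
    letI := (baseMap a b e).toAlgebra
    Algebra.FormallyEtale (MvPolynomial (Fin 2) ℂ)
      (Localization.Away (minor a b (e 0) (e 1))) := by
  let := (baseMap a b e).toAlgebra
  let A := MvPolynomial (Fin 2) ℂ
  set J := minor a b (e 0) (e 1) with hJ
  have alg : ∀ p : A, algebraMap A (Localization.Away J) p =
      algebraMap (PowerSumRing a b) _ (baseMap a b e p) := fun p => by
    rw [IsScalarTower.algebraMap_apply A (PowerSumRing a b)]; rfl
  have algC : ∀ c : ℂ, algebraMap (PowerSumRing a b) (Localization.Away J) (algebraMap ℂ _ c) =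
      algebraMap A _ (MvPolynomial.C c) := fun c => by
    rw [alg]; exact congrArg _ ((baseMap a b e).commutes c).symm
  have algX2 : algebraMap (PowerSumRing a b) (Localization.Away J) (x a b (e 2)) =
      algebraMap A _ (MvPolynomial.X 0) := by
    rw [alg]; simp [baseMap]
  have algX3 : algebraMap (PowerSumRing a b) (Localization.Away J) (x a b (e 3)) =
      algebraMap A _ (MvPolynomial.X 1) := by
    rw [alg]; simp [baseMap]
  rw [Algebra.FormallyEtale.iff_comp_bijective]
  intro C _ _ I hI
  have hI' : ∀ x ∈ I, ∀ y ∈ I, x * y = 0 := fun x hx y hy => by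
    have : x * y ∈ I ^ 2 := by rw [pow_two]; exact Ideal.mul_mem_mul hx hy
    rwa [hI] at this
  have unit_of_mk : ∀ c : C, IsUnit (Ideal.Quotient.mk I c) → IsUnit c := fun c hc =>
    by
      obtain ⟨d, hd⟩ := hc.exists_right_inv
      obtain ⟨d, rfl⟩ := Ideal.Quotient.mk_surjective d
      rw [← map_mul, ← map_one (Ideal.Quotient.mk I), Ideal.Quotient.eq] at hd
      exact IsUnit.of_mul_eq_one (d * (2 - c * d)) (by linear_combination - hI' _ hd _ hd)
  have unit_nat : ∀ n : ℕ, 0 < n → IsUnit (n : C) := fun n hn => by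
    have : IsUnit (n : ℂ) := IsUnit.mk0 _ (by exact_mod_cast hn.ne')
    simpa using this.map ((algebraMap A C).comp MvPolynomial.C)
  constructor
  · intro g h hgh
    have hmk : ∀ y, g y - h y ∈ I := fun y => by
      have := DFunLike.congr_fun hgh y
      exact (Ideal.Quotient.eq).mp this
    set G : PowerSumRing a b →+* C := g.toRingHom.comp (algebraMap _ _) with hG
    set H : PowerSumRing a b →+* C := h.toRingHom.comp (algebraMap _ _) with hH
    have e2 : G (x a b (e 2)) = H (x a b (e 2)) := by
      change g (algebraMap _ _ _) = h (algebraMap _ _ _)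
      rw [algX2, g.commutes, h.commutes]
    have e3 : G (x a b (e 3)) = H (x a b (e 3)) := by
      change g (algebraMap _ _ _) = h (algebraMap _ _ _)
      rw [algX3, g.commutes, h.commutes]
    have sums : ∀ F : PowerSumRing a b →+* C, ∀ n, ∑ i, x a b i ^ n = 0 →
        F (x a b (e 0)) ^ n + F (x a b (e 1)) ^ n + F (x a b (e 2)) ^ n +
          F (x a b (e 3)) ^ n = 0 := fun F n h => by
      have := congrArg F h
      simpa [sum_perm e] using this
    have hu : IsUnit (H J) := (IsLocalization.Away.algebraMap_isUnit J).map h.toRingHom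
    simp only [hJ, minor, map_sub, map_mul, map_pow] at hu
    obtain ⟨e0, e1⟩ := newton_step_unique hI' ha hb (unit_nat a ha) (unit_nat b hb) hu
      (hmk _ : G (x a b (e 0)) - H (x a b (e 0)) ∈ I)
      (hmk _ : G (x a b (e 1)) - H (x a b (e 1)) ∈ I)
      (by
        have h1 := sums G a sum_x_pow_left
        have h2 := sums H a sum_x_pow_left
        rw [e2, e3] at h1
        linear_combination h1 - h2)
      (by
        have h1 := sums G b sum_x_pow_right
        have h2 := sums H b sum_x_pow_right
        rw [e2, e3] at h1
        linear_combination h1 - h2)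
    have hGH : G = H := ringHom_ext
      (fun c => by
        change g (algebraMap _ _ _) = h (algebraMap _ _ _)
        rw [algC, g.commutes, h.commutes])
      (forall_perm e e0 e1 e2 e3)
    have : g.toRingHom = h.toRingHom := IsLocalization.ringHom_ext (Submonoid.powers J) hGH
    exact AlgHom.coe_ringHom_injective this
  · intro φ
    set Φ : PowerSumRing a b →+* C ⧸ I := φ.toRingHom.comp (algebraMap _ _) with hΦ
    have φalg : ∀ p : A, φ (algebraMap A _ p) = Ideal.Quotient.mk I (algebraMap A C p) :=
      fun p => φ.commutes p
    obtain ⟨X, hX⟩ := Ideal.Quotient.mk_surjective (Φ (x a b (e 0)))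
    obtain ⟨Y, hY⟩ := Ideal.Quotient.mk_surjective (Φ (x a b (e 1)))
    set Z := algebraMap A C (MvPolynomial.X 0) with hZ
    set W := algebraMap A C (MvPolynomial.X 1) with hW
    have hZ' : Ideal.Quotient.mk I Z = Φ (x a b (e 2)) := by
      change _ = φ (algebraMap _ _ _)
      rw [algX2, φalg]
    have hW' : Ideal.Quotient.mk I W = Φ (x a b (e 3)) := by
      change _ = φ (algebraMap _ _ _)
      rw [algX3, φalg]
    have sums : ∀ n, ∑ i, x a b i ^ n = 0 → X ^ n + Y ^ n + (Z ^ n + W ^ n) ∈ I := fun n h => by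
      have := congrArg Φ h
      rw [sum_perm e] at this
      rw [← Ideal.Quotient.eq_zero_iff_mem]
      simp only [map_add, map_pow, map_zero, hX, hY, hZ', hW'] at this ⊢
      rw [← this]; ring
    have hu : IsUnit (X ^ (a - 1) * Y ^ (b - 1) - X ^ (b - 1) * Y ^ (a - 1)) := by
      apply unit_of_mk
      have : IsUnit (Φ J) := (IsLocalization.Away.algebraMap_isUnit J).map φ.toRingHom
      simpa [hJ, minor, hX, hY] using this
    obtain ⟨δ, hδ, ε, hε, h1, h2⟩ := exists_newton_step hI' ha hb (unit_nat a ha) (unit_nat b hb)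
      hu (sums a sum_x_pow_left) (sums b sum_x_pow_right)
    let v : Fin 4 → C := fun i => ![X + δ, Y + ε, Z, W] (e.symm i)
    have v0 : v (e 0) = X + δ := by simp [v]
    have v1 : v (e 1) = Y + ε := by simp [v]
    have v2 : v (e 2) = Z := by simp [v]
    have v3 : v (e 3) = W := by simp [v]
    let Ψ : PowerSumRing a b →+* C := lift ((algebraMap A C).comp MvPolynomial.C) v
      (by rw [sum_perm e, v0, v1, v2, v3]; linear_combination h1)
      (by rw [sum_perm e, v0, v1, v2, v3]; linear_combination h2)
    have hΨ : (Ideal.Quotient.mk I).comp Ψ = Φ := by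
      have hδ' := Ideal.Quotient.eq_zero_iff_mem.mpr hδ
      have hε' := Ideal.Quotient.eq_zero_iff_mem.mpr hε
      apply ringHom_ext
      · intro c
        simp only [Ψ, RingHom.comp_apply, lift_algebraMap, hΦ, algC]
        exact (φalg _).symm
      · refine forall_perm e ?_ ?_ ?_ ?_
        · simp [Ψ, v0, hδ', hX]
        · simp [Ψ, v1, hε', hY]
        · simp [Ψ, v2, hZ']
        · simp [Ψ, v3, hW']
    have hΨJ : IsUnit (Ψ J) := by
      apply unit_of_mk
      rw [← RingHom.comp_apply, hΨ]
      exact (IsLocalization.Away.algebraMap_isUnit J).map φ.toRingHom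
    let ψ : Localization.Away J →+* C := IsLocalization.Away.lift J hΨJ
    have hψ : ∀ r, ψ (algebraMap _ _ r) = Ψ r := fun r => IsLocalization.Away.lift_eq J hΨJ r
    have hψA : ψ.comp (algebraMap A _) = algebraMap A C := by
      apply MvPolynomial.ringHom_ext
      · intro c
        rw [RingHom.comp_apply, ← algC, hψ]
        simp [Ψ]
      · intro i
        rw [RingHom.comp_apply]
        fin_cases i
        · simp only [Fin.zero_eta]
          rw [← algX2, hψ]; simp [Ψ, v2, hZ]
        · simp only [Fin.mk_one]
          rw [← algX3, hψ]; simp [Ψ, v3, hW]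
    refine ⟨{ ψ with commutes' := fun p => DFunLike.congr_fun hψA p }, ?_⟩
    apply AlgHom.coe_ringHom_injective
    apply IsLocalization.ringHom_ext (Submonoid.powers J)
    refine Eq.trans ?_ hΨ
    exact RingHom.ext fun r => congrArg (Ideal.Quotient.mk I) (hψ r)

theorem etale_away_minor (ha : 0 < a) (hb : 0 < b) (e : Equiv.Perm (Fin 4)) :
    letI := (baseMap a b e).toAlgebra
    Algebra.Etale (MvPolynomial (Fin 2) ℂ) (Localization.Away (minor a b (e 0) (e 1))) := by
  let := (baseMap a b e).toAlgebra
  have : IsScalarTower ℂ (MvPolynomial (Fin 2) ℂ) (PowerSumRing a b) :=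
    IsScalarTower.of_algebraMap_eq fun c => ((baseMap a b e).commutes c).symm
  have h1 : Algebra.FiniteType (MvPolynomial (Fin 2) ℂ) (PowerSumRing a b) :=
    Algebra.FiniteType.of_restrictScalars_finiteType ℂ _ _
  have h2 : Algebra.FiniteType (PowerSumRing a b) (Localization.Away (minor a b (e 0) (e 1))) :=
    IsLocalization.finiteType_of_monoid_fg (Submonoid.powers (minor a b (e 0) (e 1))) _
  have h3 := h1.trans h2
  exact ⟨formallyEtale_away_minor ha hb e, Algebra.FinitePresentation.of_finiteType.mp h3⟩

end PowerSumRing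

/-! ### Valuations and roots of unity -/

section Arithmetic

theorem exists_not_dvd_and_dvd_mul {p : ℕ} [Fact p.Prime] {a d : ℕ} (hd : d ≠ 0)
    (h : padicValNat p d ≤ padicValNat p a) : ∃ t, ¬ p ∣ t ∧ d ∣ a * t := by
  -- The witness is the prime-to-`p` part of `d`.
  obtain ⟨t, ht⟩ : p ^ padicValNat p d ∣ d := pow_padicValNat_dvd
  refine ⟨t, fun hpt => ?_, ?_⟩
  · apply pow_succ_padicValNat_not_dvd (p := p) hd
    nth_rewrite 2 [ht]
    rw [pow_succ]
    exact mul_dvd_mul_left _ hpt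
  · nth_rewrite 1 [ht]
    exact mul_dvd_mul_right ((pow_dvd_pow p h).trans pow_padicValNat_dvd) t

/-- If `b - a` were divisible by a higher power of `p` than `a` is, adding it to `a` would not
change the valuation. -/
theorem padicValNat_sub_le_of_ne {p : ℕ} [Fact p.Prime] {a b : ℕ} (ha : 0 < a) (hab : a < b)
    (h : padicValNat p a ≠ padicValNat p b) : padicValNat p (b - a) ≤ padicValNat p a := by
  by_contra! hlt
  have hd : b - a ≠ 0 := by omega
  have key : ∀ k ≤ padicValNat p (b - a), p ^ k ∣ a ↔ p ^ k ∣ b := fun k hk => by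
    have h1 : p ^ k ∣ b - a := (pow_dvd_pow p hk).trans pow_padicValNat_dvd
    have h2 : b = a + (b - a) := by omega
    rw [h2]
    exact (Nat.dvd_add_left h1).symm
  apply h
  apply le_antisymm
  · rw [← padicValNat_dvd_iff_le (by omega)]
    exact (key _ hlt.le).mp pow_padicValNat_dvd
  · by_contra! hlt'
    have : p ^ (padicValNat p a + 1) ∣ b := (padicValNat_dvd_iff_le (by omega)).mpr hlt'
    exact pow_succ_padicValNat_not_dvd ha.ne' ((key _ hlt).mpr this)

/-- If `ν₂ a ≠ ν₂ b` then no `z` with `z ^ (b - a) = 1` has `z ^ a = -1`. -/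
theorem one_add_pow_ne_zero {a b : ℕ} (ha : 0 < a) (hab : a < b)
    (h2 : padicValNat 2 a ≠ padicValNat 2 b) {z : ℂ} (hz : z ^ (b - a) = 1) : 1 + z ^ a ≠ 0 := by
  intro h
  obtain ⟨t, ht, s, hs⟩ := exists_not_dvd_and_dvd_mul (p := 2) (by omega : b - a ≠ 0)
    (padicValNat_sub_le_of_ne ha hab h2)
  have h1 : (z ^ a) ^ t = 1 := by rw [← pow_mul, hs, pow_mul, hz, one_pow]
  rw [show z ^ a = -1 by linear_combination h, Odd.neg_one_pow] at h1
  · norm_num at h1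
  · rw [← Nat.not_even_iff_odd, even_iff_two_dvd]; exact ht

/-- If `ν₃ (b - a) ≤ ν₃ a` then no `z` with `z ^ (b - a) = 1` has `z ^ a` a primitive cube root
of unity. -/
theorem one_add_pow_add_sq_ne_zero {a b : ℕ} (hab : a < b)
    (h3 : padicValNat 3 (b - a) ≤ padicValNat 3 a) {z : ℂ} (hz : z ^ (b - a) = 1) :
    1 + z ^ a + (z ^ a) ^ 2 ≠ 0 := by
  intro h
  obtain ⟨t, ht, s, hs⟩ := exists_not_dvd_and_dvd_mul (p := 3) (by omega : b - a ≠ 0) h3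
  have h1 : (z ^ a) ^ t = 1 := by rw [← pow_mul, hs, pow_mul, hz, one_pow]
  have h2 : (z ^ a) ^ 3 = 1 := by linear_combination (z ^ a - 1) * h
  have hcop : Nat.gcd t 3 = 1 := (Nat.coprime_comm.mp
    ((Nat.Prime.coprime_iff_not_dvd Nat.prime_three).mpr ht))
  have h4 : z ^ a = 1 := by
    have h5 : orderOf (z ^ a) ∣ Nat.gcd t 3 :=
      Nat.dvd_gcd (orderOf_dvd_of_pow_eq_one h1) (orderOf_dvd_of_pow_eq_one h2)
    rw [hcop, Nat.dvd_one, orderOf_eq_one_iff] at h5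
    exact h5
  rw [h4] at h
  norm_num at h

theorem exists_mul_pow_add_eq_zero_and_ne {a b : ℕ} (ha : 0 < a) (hab : a < b) {c₁ c₂ : ℂ}
    (h₁ : c₁ ≠ 0) (h₂ : c₂ ≠ 0) : ∃ y : ℂ, c₁ * y ^ b + c₂ = 0 ∧ c₁ * y ^ a + c₂ ≠ 0 := by
  by_contra! h
  obtain ⟨y, hy⟩ := IsAlgClosed.exists_pow_nat_eq (-c₂ / c₁) (by omega : 0 < b)
  have hy' : c₁ * y ^ b + c₂ = 0 := by rw [hy]; field_simp; ring
  -- If every root `y` of the first equation also solved the second, comparing `y` with `y * η`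
  -- would give `η ^ a = 1`, impossible for a primitive root of order `b > a`.
  have hη := Complex.isPrimitiveRoot_exp b (by omega)
  set η := Complex.exp (2 * Real.pi * Complex.I / b)
  have e1 := h y hy'
  have e2 := h (y * η) (by rw [mul_pow, hη.pow_eq_one, mul_one, hy'])
  have hya : c₁ * y ^ a ≠ 0 := fun h0 => h₂ (by rw [h0, zero_add] at e1; exact e1)
  have : η ^ a = 1 := by
    apply mul_left_cancel₀ hya
    rw [mul_pow] at e2
    linear_combination e2 - e1
  exact absurd (Nat.le_of_dvd ha (hη.dvd_of_pow_eq_one _ this)) (by omega)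

theorem exists_mul_eq_mul_and_neg_one_pow_ne {a b : ℕ} (ha : 0 < a) (hb : 0 < b)
    (h2 : padicValNat 2 a ≠ padicValNat 2 b) :
    ∃ r s : ℕ, a * r = b * s ∧ (-1 : ℂ) ^ r ≠ (-1) ^ s := by
  have key : ∀ a b : ℕ, 0 < a → 0 < b → padicValNat 2 a < padicValNat 2 b →
      ∃ r s : ℕ, a * r = b * s ∧ (-1 : ℂ) ^ r ≠ (-1) ^ s := by
    intro a b ha hb h
    obtain ⟨s, hs⟩ : 2 ^ padicValNat 2 a ∣ a := pow_padicValNat_dvd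
    obtain ⟨r, hr⟩ : 2 ^ (padicValNat 2 a + 1) ∣ b :=
      (pow_dvd_pow 2 h).trans pow_padicValNat_dvd
    have hs' : Odd s := by
      rw [← Nat.not_even_iff_odd, even_iff_two_dvd]
      intro hpt
      apply pow_succ_padicValNat_not_dvd (p := 2) ha.ne'
      nth_rewrite 2 [hs]
      rw [pow_succ]
      exact mul_dvd_mul_left _ hpt
    refine ⟨2 * r, s, ?_, ?_⟩
    · nth_rewrite 1 [hs]
      nth_rewrite 1 [hr]
      ring
    · rw [hs'.neg_one_pow, pow_mul]
      norm_num
  rcases lt_or_gt_of_ne h2 with h | h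
  · exact key a b ha hb h
  · obtain ⟨r, s, h1, h2⟩ := key b a hb ha h
    exact ⟨s, r, h1.symm, h2.symm⟩

end Arithmetic

/-! ### Coprimality of diagonal forms by elimination -/

section Coprime

open MvPolynomial

variable {σ : Type*}

theorem MvPolynomial.degreeOf_eq_zero_of_dvd_of_mem_supported {v : σ} {p m : MvPolynomial σ ℂ}
    (hpm : p ∣ m) (hm : m ≠ 0) (hv : m ∈ supported ℂ ({v}ᶜ : Set σ)) : p.degreeOf v = 0 := by
  classical
  obtain ⟨q, rfl⟩ := hpm
  have h : (p * q).degreeOf v = 0 := by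
    rw [mem_supported] at hv
    by_contra h
    have hmem : v ∈ (p * q).vars := by
      rw [vars_def, Multiset.mem_toFinset]
      exact Multiset.count_pos.mp (Nat.pos_of_ne_zero (by rwa [degreeOf_def] at h))
    exact hv hmem rfl
  rw [degreeOf_mul_eq (left_ne_zero_of_mul hm) (right_ne_zero_of_mul hm)] at h
  omega

theorem MvPolynomial.isUnit_of_forall_degreeOf_eq_zero {p : MvPolynomial σ ℂ} (hp : p ≠ 0)
    (h : ∀ v, p.degreeOf v = 0) : IsUnit p := by
  classical
  have h1 : p.vars = ∅ := by
    rw [vars_def, Multiset.toFinset_eq_empty]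
    exact Multiset.eq_zero_of_forall_notMem fun v hv =>
      (Multiset.count_pos.mpr hv).ne' (h v)
  rw [vars_eq_empty_iff_eq_C] at h1
  rw [h1] at hp ⊢
  exact (IsUnit.mk0 _ fun h0 => hp (by rw [h0, C_0])).map C

/-- Modulo `p`, `(c X^a)^r` is `(-F)^r` and `(c X^b)^s` is `(-G)^s`. As `a r = b s`, the variable
`v` cancels, leaving a nonzero multiple of `p` free of `v`. -/
theorem MvPolynomial.degreeOf_eq_zero_of_dvd_of_dvd {p F G : MvPolynomial σ ℂ} {v : σ} {a b r s : ℕ}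
    (hrs : a * r = b * s) {c : ℂ} (hF : F ∈ supported ℂ ({v}ᶜ : Set σ))
    (hG : G ∈ supported ℂ ({v}ᶜ : Set σ)) (hpF : p ∣ C c * X v ^ a + F)
    (hpG : p ∣ C c * X v ^ b + G)
    (h0 : C (c ^ s) * (-F) ^ r - C (c ^ r) * (-G) ^ s ≠ 0) : p.degreeOf v = 0 := by
  refine degreeOf_eq_zero_of_dvd_of_mem_supported ?_ h0 ?_
  · have h1 : p ∣ C c * X v ^ a - -F := by rwa [sub_neg_eq_add]
    have h2 : p ∣ C c * X v ^ b - -G := by rwa [sub_neg_eq_add]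
    have h3 := (h1.trans (sub_dvd_pow_sub_pow _ _ r)).mul_left (C (c ^ s))
    have h4 := (h2.trans (sub_dvd_pow_sub_pow _ _ s)).mul_left (C (c ^ r))
    have h5 := dvd_sub h4 h3
    convert h5 using 1
    have h6 : (X v : MvPolynomial σ ℂ) ^ (a * r) = X v ^ (b * s) := by rw [hrs]
    rw [mul_pow, mul_pow, ← pow_mul, ← pow_mul, C_pow, C_pow]
    linear_combination (C c ^ r * C c ^ s) * h6
  · have hC : ∀ c : ℂ, (C c : MvPolynomial σ ℂ) ∈ supported ℂ ({v}ᶜ : Set σ) := fun c =>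
      Subalgebra.algebraMap_mem _ c
    exact sub_mem (mul_mem (hC _) (pow_mem (neg_mem hF) _)) (mul_mem (hC _) (pow_mem (neg_mem hG) _))

theorem MvPolynomial.X_mem_supported_compl {v w : σ} (h : w ≠ v) :
    (X w : MvPolynomial σ ℂ) ∈ supported ℂ ({v}ᶜ : Set σ) :=
  (X_mem_supported).mpr h

theorem MvPolynomial.term_mem_supported_compl {v w : σ} (h : w ≠ v) (c : ℂ) (n : ℕ) :
    (C c * X w ^ n : MvPolynomial σ ℂ) ∈ supported ℂ ({v}ᶜ : Set σ) :=
  mul_mem (Subalgebra.algebraMap_mem _ c) (pow_mem (X_mem_supported_compl h) _)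

theorem MvPolynomial.degreeOf_eq_zero_of_dvd_diagonal {p : MvPolynomial σ ℂ} {u v w : σ} {a b : ℕ}
    (ha : 0 < a) (hab : a < b) (huv : u ≠ v) (huw : u ≠ w) (hvw : v ≠ w) {c₁ c₂ c₃ : ℂ}
    (h₁ : c₁ ≠ 0) (h₂ : c₂ ≠ 0) (h₃ : c₃ ≠ 0)
    (hpa : p ∣ C c₁ * X u ^ a + (C c₂ * X v ^ a + C c₃ * X w ^ a))
    (hpb : p ∣ C c₁ * X u ^ b + (C c₂ * X v ^ b + C c₃ * X w ^ b)) : p.degreeOf u = 0 := by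
  classical
  refine degreeOf_eq_zero_of_dvd_of_dvd (mul_comm a b)
    (add_mem (term_mem_supported_compl huv.symm _ _) (term_mem_supported_compl huw.symm _ _))
    (add_mem (term_mem_supported_compl huv.symm _ _) (term_mem_supported_compl huw.symm _ _))
    hpa hpb fun h => ?_
  -- At `X v = y`, `X w = 1` the tail of the `b`-form vanishes and that of the `a`-form does not, so
  -- the eliminant is nonzero.
  obtain ⟨y, hy, hy'⟩ := exists_mul_pow_add_eq_zero_and_ne ha hab h₂ h₃
  have := congrArg (eval fun m => if m = v then y else 1) h
  simp only [map_sub, map_mul, map_pow, map_neg, map_add, eval_C, eval_X, if_true,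
    if_neg hvw.symm, one_pow, mul_one, hy, neg_zero, zero_pow ha.ne', mul_zero, sub_zero, map_zero,
    mul_eq_zero, pow_eq_zero_iff', neg_eq_zero, h₁, hy', false_and, or_false] at this

end Coprime

/-! ### Nonzerodivisors and the regular sequence -/

section Regular

variable {S : Type*} [CommRing S] [IsDomain S] [UniqueFactorizationMonoid S]

/-- Here `ρ` plays the role of reduction modulo `t`. A relation between the coprime elements `ρ f`
and `ρ g` is a multiple of the Koszul relation; subtracting its lift makes the remaining
coefficients divisible by `t`, which is then cancelled. -/
theorem mem_span_pair_of_mul_mem {ρ : S →+* S} {t f g h : S} (ht : t ≠ 0) (hρt : ρ t = 0)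
    (hρ : ∀ p, t ∣ p - ρ p) (hfg : IsRelPrime (ρ f) (ρ g)) (hf : ρ f ≠ 0)
    (hh : t * h ∈ Ideal.span {f, g}) : h ∈ Ideal.span {f, g} := by
  obtain ⟨u, v, huv⟩ := Ideal.mem_span_pair.mp hh
  have h0 : ρ u * ρ f + ρ v * ρ g = 0 := by
    rw [← map_mul, ← map_mul, ← map_add, huv, map_mul, hρt, zero_mul]
  obtain ⟨w, hw⟩ : ρ f ∣ ρ v := by
    refine hfg.dvd_of_dvd_mul_right ⟨-ρ u, ?_⟩
    linear_combination h0
  have hu : ρ u = - (w * ρ g) := by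
    apply mul_left_cancel₀ hf
    linear_combination h0 - ρ g * hw
  obtain ⟨u', hu'⟩ := hρ u
  obtain ⟨v', hv'⟩ := hρ v
  obtain ⟨f', hf'⟩ := hρ f
  obtain ⟨g', hg'⟩ := hρ g
  refine Ideal.mem_span_pair.mpr ⟨u' + w * g', v' - w * f', ?_⟩
  apply mul_left_cancel₀ ht
  linear_combination huv - f * hu' - g * hv' - f * hu - g * hw + w * g * hf' - w * f * hg'

end Regular

namespace PowerSumRing

open MvPolynomial

variable {a b : ℕ}

/-- The endomorphism substituting `ζ * X j` for `X i`. -/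
noncomputable def subst (i j : Fin 4) (ζ : ℂ) : MvPolynomial (Fin 4) ℂ →ₐ[ℂ] MvPolynomial (Fin 4) ℂ :=
  aeval (Function.update X i (C ζ * X j))

@[simp]
theorem subst_X_self (i j : Fin 4) (ζ : ℂ) : subst i j ζ (X i) = C ζ * X j := by
  simp [subst]

@[simp]
theorem subst_C (i j : Fin 4) (ζ c : ℂ) : subst i j ζ (C c) = C c :=
  (subst i j ζ).commutes c

theorem subst_X_of_ne {i j k : Fin 4} (h : k ≠ i) (ζ : ℂ) : subst i j ζ (X k) = X k := by
  simp [subst, Function.update_of_ne h]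

theorem dvd_sub_subst (i j : Fin 4) (ζ : ℂ) (p : MvPolynomial (Fin 4) ℂ) :
    X i - C ζ * X j ∣ p - subst i j ζ p := by
  rw [← Ideal.mem_span_singleton, ← Ideal.Quotient.eq]
  set I := Ideal.span {(X i - C ζ * X j : MvPolynomial (Fin 4) ℂ)}
  have : Ideal.Quotient.mk I = (Ideal.Quotient.mk I).comp (subst i j ζ).toRingHom := by
    apply MvPolynomial.ringHom_ext
    · intro c; simp
    · intro k
      by_cases hk : k = i
      · subst hk
        simp only [RingHom.comp_apply, AlgHom.toRingHom_eq_coe, RingHom.coe_coe, subst_X_self]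
        rw [Ideal.Quotient.eq]
        exact Ideal.mem_span_singleton_self _
      · simp [subst_X_of_ne hk]
  exact DFunLike.congr_fun this p

theorem psum_eq (e : Equiv.Perm (Fin 4)) (n : ℕ) : psum (Fin 4) ℂ n =
    X (e 0) ^ n + X (e 1) ^ n + X (e 2) ^ n + X (e 3) ^ n := by
  rw [psum, sum_perm e]

theorem subst_psum (e : Equiv.Perm (Fin 4)) (ζ : ℂ) (n : ℕ) :
    subst (e 0) (e 1) ζ (psum (Fin 4) ℂ n) =
      C (1 + ζ ^ n) * X (e 1) ^ n + X (e 2) ^ n + X (e 3) ^ n := by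
  rw [psum_eq e]
  have h : ∀ i : Fin 4, i ≠ 0 → subst (e 0) (e 1) ζ (X (e i)) = X (e i) := fun i hi =>
    subst_X_of_ne (e.injective.ne hi) ζ
  simp only [map_add, map_pow, subst_X_self, h 1 (by decide), h 2 (by decide), h 3 (by decide),
    map_one]
  ring

theorem isRelPrime_subst_psum (ha : 0 < a) (hab : a < b) (e : Equiv.Perm (Fin 4)) {ζ : ℂ}
    (hζ : ζ ^ a = ζ ^ b) (h0 : 1 + ζ ^ a ≠ 0) :
    IsRelPrime (subst (e 0) (e 1) ζ (psum (Fin 4) ℂ a))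
      (subst (e 0) (e 1) ζ (psum (Fin 4) ℂ b)) := by
  intro p hpa hpb
  rw [subst_psum] at hpa hpb
  rw [← hζ] at hpb
  have ne : ∀ i j : Fin 4, i ≠ j → e i ≠ e j := fun i j h => e.injective.ne h
  have hne : (C (1 + ζ ^ a) * X (e 1) ^ a + X (e 2) ^ a + X (e 3) ^ a :
      MvPolynomial (Fin 4) ℂ) ≠ 0 := fun h => by
    have := congrArg (eval (Pi.single (e 1) 1)) h
    simp [ha.ne', ne, h0] at this
  refine isUnit_of_forall_degreeOf_eq_zero (ne_zero_of_dvd_ne_zero hne hpa)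
    (forall_perm e ?_ ?_ ?_ ?_)
  · refine degreeOf_eq_zero_of_dvd_of_mem_supported hpa hne ?_
    have h : ∀ i : Fin 4, i ≠ 0 → (X (e i) : MvPolynomial (Fin 4) ℂ) ^ a ∈
        supported ℂ ({e 0}ᶜ : Set (Fin 4)) :=
      fun i hi => pow_mem (X_mem_supported_compl (ne _ _ hi)) _
    exact add_mem (add_mem (mul_mem (Subalgebra.algebraMap_mem _ _) (h 1 (by decide)))
      (h 2 (by decide))) (h 3 (by decide))
  · refine degreeOf_eq_zero_of_dvd_diagonal ha hab (ne 1 2 (by decide)) (ne 1 3 (by decide))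
      (ne 2 3 (by decide)) h0 one_ne_zero one_ne_zero ?_ ?_
    · convert hpa using 1; rw [C_1]; ring
    · convert hpb using 1; rw [C_1]; ring
  · refine degreeOf_eq_zero_of_dvd_diagonal ha hab (ne 2 1 (by decide)) (ne 2 3 (by decide))
      (ne 1 3 (by decide)) one_ne_zero h0 one_ne_zero ?_ ?_
    · convert hpa using 1; rw [C_1]; ring
    · convert hpb using 1; rw [C_1]; ring
  · refine degreeOf_eq_zero_of_dvd_diagonal ha hab (ne 3 1 (by decide)) (ne 3 2 (by decide))
      (ne 1 2 (by decide)) one_ne_zero h0 one_ne_zero ?_ ?_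
    · convert hpa using 1; rw [C_1]; ring
    · convert hpb using 1; rw [C_1]; ring

theorem isRelPrime_two_variables (ha : 0 < a) (hab : a < b)
    (h2 : padicValNat 2 a ≠ padicValNat 2 b) (e : Equiv.Perm (Fin 4)) :
    IsRelPrime (X (e 2) ^ a + X (e 3) ^ a : MvPolynomial (Fin 4) ℂ)
      (X (e 2) ^ b + X (e 3) ^ b) := by
  intro p hpa hpb
  have ne : ∀ i j : Fin 4, i ≠ j → e i ≠ e j := fun i j h => e.injective.ne h
  have hne : (X (e 2) ^ a + X (e 3) ^ a : MvPolynomial (Fin 4) ℂ) ≠ 0 := fun h => by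
    have := congrArg (eval (Pi.single (e 2) 1)) h
    simp [ha.ne', ne] at this
  obtain ⟨r, s, hrs, hneg⟩ := exists_mul_eq_mul_and_neg_one_pow_ne ha (ha.trans hab) h2
  have key : ∀ u v : Fin 4, u ≠ v → p ∣ X u ^ a + X v ^ a → p ∣ X u ^ b + X v ^ b →
      p.degreeOf u = 0 := by
    intro u v huv hpa hpb
    refine degreeOf_eq_zero_of_dvd_of_dvd (c := 1) hrs
      (pow_mem (X_mem_supported_compl huv.symm) a) (pow_mem (X_mem_supported_compl huv.symm) b)
      (by rwa [C_1, one_mul]) (by rwa [C_1, one_mul]) fun h => hneg ?_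
    have := congrArg (eval fun _ => (1 : ℂ)) h
    simpa [sub_eq_zero] using this
  have hother : ∀ i : Fin 4, i ≠ 2 → i ≠ 3 → p.degreeOf (e i) = 0 := fun i hi2 hi3 =>
    degreeOf_eq_zero_of_dvd_of_mem_supported hpa hne
      (add_mem (pow_mem (X_mem_supported_compl (ne _ _ hi2.symm)) _)
        (pow_mem (X_mem_supported_compl (ne _ _ hi3.symm)) _))
  refine isUnit_of_forall_degreeOf_eq_zero (ne_zero_of_dvd_ne_zero hne hpa)
    (forall_perm e (hother 0 (by decide) (by decide)) (hother 1 (by decide) (by decide)) ?_ ?_)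
  · exact key _ _ (ne 2 3 (by decide)) hpa hpb
  · exact key _ _ (ne 3 2 (by decide)) (by rwa [add_comm]) (by rwa [add_comm])

theorem X_sub_C_mul_X_ne_zero {i j : Fin 4} (hij : i ≠ j) (ζ : ℂ) :
    (X i - C ζ * X j : MvPolynomial (Fin 4) ℂ) ≠ 0 := fun h => by
  have := congrArg (eval (Pi.single i 1)) h
  simp [hij.symm] at this

theorem algebraMap_eq_mk_C (c : ℂ) :
    algebraMap ℂ (PowerSumRing a b) c = Ideal.Quotient.mk _ (C c) := rfl

theorem eq_zero_of_x_sub_mul_eq_zero (ha : 0 < a) (hab : a < b) (e : Equiv.Perm (Fin 4)) {ζ : ℂ}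
    (hζ : ζ ^ a = ζ ^ b) (h0 : 1 + ζ ^ a ≠ 0) {r : PowerSumRing a b}
    (hr : (x a b (e 0) - algebraMap ℂ (PowerSumRing a b) ζ * x a b (e 1)) * r = 0) : r = 0 := by
  obtain ⟨h, rfl⟩ := Ideal.Quotient.mk_surjective r
  have ne : ∀ i j : Fin 4, i ≠ j → e i ≠ e j := fun i j h => e.injective.ne h
  rw [algebraMap_eq_mk_C, x, x, ← map_mul, ← map_sub, ← map_mul,
    Ideal.Quotient.eq_zero_iff_mem] at hr
  rw [Ideal.Quotient.eq_zero_iff_mem]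
  have h1 : (subst (e 0) (e 1) ζ).toRingHom (X (e 0) - C ζ * X (e 1)) = 0 := by
    simp [subst_X_of_ne (ne 1 0 (by decide))]
  have h2 : (subst (e 0) (e 1) ζ).toRingHom (psum (Fin 4) ℂ a) ≠ 0 := by
    intro h
    have h' := (subst_psum e ζ a).symm.trans h
    have := congrArg (eval (Pi.single (e 1) 1)) h'
    simp [ha.ne', ne, h0] at this
  exact mem_span_pair_of_mul_mem (X_sub_C_mul_X_ne_zero (ne 0 1 (by decide)) ζ) h1
    (dvd_sub_subst _ _ ζ) (isRelPrime_subst_psum ha hab e hζ h0) h2 hr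

theorem eq_zero_of_x_mul_eq_zero (ha : 0 < a) (hab : a < b) (e : Equiv.Perm (Fin 4))
    {r : PowerSumRing a b} (hr : x a b (e 0) * r = 0) : r = 0 :=
  eq_zero_of_x_sub_mul_eq_zero ha hab e (ζ := (0 : ℂ))
    (by rw [zero_pow ha.ne', zero_pow (ha.trans hab).ne']) (by simp [ha.ne'])
    (by rw [map_zero (algebraMap ℂ (PowerSumRing a b)), zero_mul, sub_zero]; exact hr)

theorem eq_zero_of_x_pow_mul_eq_zero (ha : 0 < a) (hab : a < b) (e : Equiv.Perm (Fin 4)) (n : ℕ)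
    {r : PowerSumRing a b} (hr : x a b (e 0) ^ n * r = 0) : r = 0 := by
  induction n with
  | zero => simpa using hr
  | succ n ih =>
    rw [pow_succ', mul_assoc] at hr
    exact ih (eq_zero_of_x_mul_eq_zero ha hab e hr)

/-- Up to sign the minor is a product of powers of the two variables and of the forms `x (e 0) - ζ x
(e 1)` with `ζ ^ (b - a) = 1`. The 2-adic hypothesis gives `1 + ζ ^ a ≠ 0`, so each factor is a
nonzerodivisor. -/
theorem eq_zero_of_minor_mul_eq_zero (ha : 0 < a) (hab : a < b)
    (h2 : padicValNat 2 a ≠ padicValNat 2 b) (e : Equiv.Perm (Fin 4))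
    {r : PowerSumRing a b} (hr : minor a b (e 0) (e 1) * r = 0) : r = 0 := by
  have hd : 0 < b - a := by omega
  have : NeZero (b - a) := ⟨hd.ne'⟩
  -- The factorization is proved in a polynomial ring and then specialized, since the quotient is
  -- not yet known to be a domain.
  have hprod : ∏ ζ ∈ Polynomial.nthRootsFinset (b - a) (1 : ℂ),
      (X 0 - C ζ * X 1 : MvPolynomial (Fin 2) ℂ) = X 0 ^ (b - a) - X 1 ^ (b - a) := by
    obtain ⟨η, hη⟩ : ∃ η : ℂ, IsPrimitiveRoot η (b - a) :=
      ⟨_, Complex.isPrimitiveRoot_exp (b - a) hd.ne'⟩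
    have hη' := hη.map_of_injective (C_injective (Fin 2) ℂ)
    rw [hη'.pow_sub_pow_eq_prod_sub_mul _ _ hd]
    refine Finset.prod_bij (fun ζ _ => C ζ) ?_ ?_ ?_ ?_
    · intro ζ hζ
      rw [Polynomial.mem_nthRootsFinset hd] at hζ ⊢
      rw [← C_pow, hζ, C_1]
    · intro ζ _ ζ' _ h
      exact C_injective _ _ h
    · intro p hp
      rw [Polynomial.mem_nthRootsFinset hd] at hp
      obtain ⟨i, _, hi⟩ := hη'.eq_pow_of_pow_eq_one hp
      refine ⟨η ^ i, ?_, ?_⟩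
      · rw [Polynomial.mem_nthRootsFinset hd, ← pow_mul, mul_comm i, pow_mul, hη.pow_eq_one, one_pow]
      · rw [C_pow]; exact hi
    · intro ζ _
      rfl
  have hprod' := congrArg (aeval ![x a b (e 0), x a b (e 1)]) hprod
  simp only [map_prod, map_sub, map_mul, map_pow, aeval_X, aeval_C, Matrix.cons_val_zero,
    Matrix.cons_val_one] at hprod'
  have key : ∀ s : Finset ℂ, (∀ ζ ∈ s, ζ ^ (b - a) = 1) → ∀ r : PowerSumRing a b,
      (∏ ζ ∈ s, (x a b (e 0) - algebraMap ℂ _ ζ * x a b (e 1))) * r = 0 → r = 0 := by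
    intro s
    induction s using Finset.induction_on with
    | empty => intro _ r h; simpa using h
    | insert ζ s hζs ih =>
      intro hs r hr
      rw [Finset.prod_insert hζs, mul_assoc] at hr
      have hζ := hs ζ (Finset.mem_insert_self _ _)
      refine ih (fun ζ' h => hs ζ' (Finset.mem_insert_of_mem h)) r
        (eq_zero_of_x_sub_mul_eq_zero ha hab e ?_ (one_add_pow_ne_zero ha hab h2 hζ) hr)
      calc ζ ^ a = ζ ^ (b - a) * ζ ^ a := by rw [hζ, one_mul]
        _ = ζ ^ b := by rw [← pow_add, Nat.sub_add_cancel hab.le]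
  have hb1 : b - 1 = (a - 1) + (b - a) := by omega
  have hminor : minor a b (e 0) (e 1) = - (x a b (e 1) ^ (a - 1) * (x a b (e 0) ^ (a - 1) *
      (x a b (e 0) ^ (b - a) - x a b (e 1) ^ (b - a)))) := by
    rw [minor, hb1, pow_add, pow_add]; ring
  rw [← hprod'] at hminor
  have hr1 := eq_zero_of_x_pow_mul_eq_zero ha hab ((Equiv.swap 0 1).trans e) (a - 1)
    (r := x a b (e 0) ^ (a - 1) * ((∏ ζ ∈ Polynomial.nthRootsFinset (b - a) (1 : ℂ),
      (x a b (e 0) - algebraMap ℂ _ ζ * x a b (e 1))) * r)) (by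
        rw [show ((Equiv.swap 0 1).trans e) 0 = e 1 by simp]
        rw [hminor] at hr
        linear_combination -hr)
  have hr2 := eq_zero_of_x_pow_mul_eq_zero ha hab e _ hr1
  refine key _ (fun ζ hζ => ?_) r hr2
  rwa [Polynomial.mem_nthRootsFinset hd] at hζ

/-- With `x (e 0)` and `x (e 1)` set to zero, the power sums become `X (e 2) ^ n + X (e 3) ^ n`,
coprime for `n = a, b` by the 2-adic hypothesis. Hence `x (e 1)` is a nonzerodivisor modulo `x (e
0)`. -/
theorem exists_eq_x_mul_of_x_mul_eq (ha : 0 < a) (hab : a < b)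
    (h2 : padicValNat 2 a ≠ padicValNat 2 b) (e : Equiv.Perm (Fin 4)) {r s : PowerSumRing a b}
    (hrs : x a b (e 1) * r = x a b (e 0) * s) : ∃ t, r = x a b (e 0) * t := by
  obtain ⟨p, rfl⟩ := Ideal.Quotient.mk_surjective r
  obtain ⟨q, rfl⟩ := Ideal.Quotient.mk_surjective s
  have ne : ∀ i j : Fin 4, i ≠ j → e i ≠ e j := fun i j h => e.injective.ne h
  have hmem : X (e 1) * p - X (e 0) * q ∈ powerSumIdeal a b := by
    rw [← Ideal.Quotient.eq, map_mul, map_mul]; exact hrs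
  obtain ⟨u, v, huv⟩ := Ideal.mem_span_pair.mp hmem
  set ρ := subst (e 0) (e 1) 0 with hρ
  have hρ0 : ρ (X (e 0)) = 0 := by simp [hρ]
  have hρ1 : ρ (X (e 1)) = X (e 1) := subst_X_of_ne (ne 1 0 (by decide)) 0
  have hdvd : ∀ f, X (e 0) ∣ f - ρ f := fun f => by
    simpa using dvd_sub_subst (e 0) (e 1) 0 f
  have hρn : ∀ n, 0 < n → ρ (psum (Fin 4) ℂ n) = X (e 1) ^ n + X (e 2) ^ n + X (e 3) ^ n :=
    fun n hn => by rw [hρ, subst_psum]; simp [hn.ne']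
  set τ := subst (e 1) (e 2) 0 with hτ
  have hτn : ∀ n, 0 < n → τ (ρ (psum (Fin 4) ℂ n)) = X (e 2) ^ n + X (e 3) ^ n := fun n hn => by
    rw [hρn n hn, hτ]
    simp [subst_X_of_ne (ne 2 1 (by decide)), subst_X_of_ne (ne 3 1 (by decide)), hn.ne']
  have hmem' : X (e 1) * ρ p ∈ Ideal.span {ρ (psum (Fin 4) ℂ a), ρ (psum (Fin 4) ℂ b)} := by
    rw [Ideal.mem_span_pair]
    refine ⟨ρ u, ρ v, ?_⟩
    rw [← map_mul, ← map_mul, ← map_add, huv, map_sub, map_mul, map_mul, hρ0, hρ1]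
    ring
  have hp : ρ p ∈ Ideal.span {ρ (psum (Fin 4) ℂ a), ρ (psum (Fin 4) ℂ b)} := by
    refine mem_span_pair_of_mul_mem (ρ := (τ : _ →+* MvPolynomial (Fin 4) ℂ)) (X_ne_zero _)
      (by simp [hτ]) (fun f => by simpa using dvd_sub_subst (e 1) (e 2) 0 f) ?_ ?_ hmem'
    · rw [RingHom.coe_coe, hτn a ha, hτn b (ha.trans hab)]
      exact isRelPrime_two_variables ha hab h2 e
    · rw [RingHom.coe_coe, hτn a ha]
      intro h
      have := congrArg (eval (Pi.single (e 2) 1)) h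
      simp [ha.ne', ne] at this
  obtain ⟨u', v', huv'⟩ := Ideal.mem_span_pair.mp hp
  obtain ⟨p', hp'⟩ := hdvd p
  obtain ⟨f', hf'⟩ := hdvd (psum (Fin 4) ℂ a)
  obtain ⟨g', hg'⟩ := hdvd (psum (Fin 4) ℂ b)
  refine ⟨Ideal.Quotient.mk _ (p' - u' * f' - v' * g'), ?_⟩
  have : p = X (e 0) * (p' - u' * f' - v' * g') + u' * psum (Fin 4) ℂ a + v' * psum (Fin 4) ℂ b := by
    linear_combination hp' - huv' - u' * hf' - v' * hg'
  nth_rewrite 1 [this]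
  simp only [map_add, map_mul, mk_psum_left, mk_psum_right, mul_zero, add_zero]
  rfl

theorem exists_eq_x_pow_mul_of_x_pow_mul_eq (ha : 0 < a) (hab : a < b)
    (h2 : padicValNat 2 a ≠ padicValNat 2 b) (e : Equiv.Perm (Fin 4)) (m n : ℕ)
    {r s : PowerSumRing a b} (hrs : x a b (e 1) ^ m * r = x a b (e 0) ^ n * s) :
    ∃ t, r = x a b (e 0) ^ n * t := by
  have key : ∀ (n : ℕ) (r s : PowerSumRing a b), x a b (e 1) * r = x a b (e 0) ^ n * s →
      ∃ t, r = x a b (e 0) ^ n * t := by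
    intro n
    induction n with
    | zero => intro r s _; exact ⟨r, by simp⟩
    | succ n ih =>
      intro r s hrs
      obtain ⟨r', rfl⟩ := exists_eq_x_mul_of_x_mul_eq ha hab h2 e
        (hrs.trans (by rw [pow_succ', mul_assoc]))
      obtain ⟨t, rfl⟩ := ih r' s (by
        rw [← sub_eq_zero]
        apply eq_zero_of_x_mul_eq_zero ha hab e
        linear_combination hrs)
      exact ⟨t, by ring⟩
  induction m generalizing r with
  | zero => exact ⟨s, by simpa using hrs⟩
  | succ m ih =>
    rw [pow_succ, mul_assoc] at hrs
    obtain ⟨s', hs'⟩ := ih hrs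
    exact key n r s' hs'

end PowerSumRing

/-! ### Vanishing sums on the unit circle, and idempotents -/

/-- Conjugation inverts numbers of modulus one. Four such numbers with sum zero contain an opposite
pair, because the sum and its conjugate combine to `(1 + u)(1 + v)(1 + w) = 0`; three are
proportional to the cube roots of unity. `P` records whether zero terms are allowed. -/
theorem one_add_add_add_ne_zero {P : Prop} {u v w : ℂ}
    (hu : u = 0 ∧ P ∨ starRingEnd ℂ u * u = 1 ∧ 1 + u ≠ 0 ∧ (P → 1 + u + u ^ 2 ≠ 0))
    (hv : v = 0 ∧ P ∨ starRingEnd ℂ v * v = 1 ∧ 1 + v ≠ 0 ∧ (P → 1 + v + v ^ 2 ≠ 0))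
    (hw : w = 0 ∧ P ∨ starRingEnd ℂ w * w = 1 ∧ 1 + w ≠ 0 ∧ (P → 1 + w + w ^ 2 ≠ 0)) :
    1 + u + v + w ≠ 0 := by
  have three : ∀ u v : ℂ, starRingEnd ℂ u * u = 1 → starRingEnd ℂ v * v = 1 →
      1 + u + u ^ 2 ≠ 0 → 1 + u + v ≠ 0 := by
    intro u v hu hv hu' h
    have hc := congrArg (starRingEnd ℂ) h
    simp only [map_add, map_one, map_zero] at hc
    apply hu'
    linear_combination (u + 1) * h - u * v * hc + v * hu + u * hv
  intro h
  have hc := congrArg (starRingEnd ℂ) h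
  simp only [map_add, map_one, map_zero] at hc
  rcases hu with ⟨rfl, hP⟩ | ⟨hu, hu1, hu2⟩ <;> rcases hv with ⟨rfl, hP'⟩ | ⟨hv, hv1, hv2⟩ <;>
    rcases hw with ⟨rfl, hP''⟩ | ⟨hw, hw1, hw2⟩
  · simp at h
  · exact hw1 (by linear_combination h)
  · exact hv1 (by linear_combination h)
  · exact three v w hv hw (hv2 hP) (by linear_combination h)
  · exact hu1 (by linear_combination h)
  · exact three u w hu hw (hu2 hP') (by linear_combination h)
  · exact three u v hu hv (hu2 hP'') (by linear_combination h)
  · have : (1 + u) * (1 + v) * (1 + w) = 0 := by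
      linear_combination h + u * v * w * hc - v * w * hu - u * w * hv - u * v * hw
    simp [hu1, hv1, hw1] at this

theorem Polynomial.natDegree_eq_zero_of_isIdempotentElem {R : Type*} [CommRing R] [IsReduced R]
    {p : Polynomial R} (hp : IsIdempotentElem p) : p.natDegree = 0 := by
  by_cases h0 : p = 0
  · simp [h0]
  · have h1 : p.leadingCoeff * p.leadingCoeff ≠ 0 := fun h =>
      h0 (Polynomial.leadingCoeff_eq_zero.mp (IsNilpotent.eq_zero ⟨2, by rw [sq, h]⟩))
    have h2 := Polynomial.natDegree_mul' h1
    rw [hp.eq] at h2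
    omega

theorem Polynomial.sum_C_mul_X_pow_eq_zero {R ι : Type*} [CommRing R] [Fintype ι] {f : ι → R}
    {n : ℕ} (h : ∑ i, f i ^ n = 0) :
    ∑ i, (Polynomial.C (f i) * (Polynomial.X : Polynomial R)) ^ n = 0 := by
  simp only [mul_pow, ← Polynomial.C_pow]
  rw [← Finset.sum_mul, ← map_sum, h, map_zero, zero_mul]

theorem Polynomial.eq_of_isIdempotentElem_of_eval {R : Type*} [CommRing R] [IsReduced R]
    {τ : R →+* Polynomial R} (h1 : (Polynomial.evalRingHom 1).comp τ = RingHom.id R) {w c : R}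
    (hw : IsIdempotentElem w) (h0 : (Polynomial.evalRingHom 0).comp τ w = c) : w = c := by
  obtain ⟨d, hd⟩ := Polynomial.natDegree_eq_zero.mp
    (Polynomial.natDegree_eq_zero_of_isIdempotentElem (hw.map τ))
  have e1 : d = w := by
    have := DFunLike.congr_fun h1 w
    simpa [← hd] using this
  simpa [← hd, e1] using h0

/-! ### The isolated singularity and normality -/

namespace PowerSumRing

open MvPolynomial

variable {a b : ℕ}

theorem exists_perm {i j : Fin 4} (hij : i ≠ j) : ∃ e : Equiv.Perm (Fin 4), e 0 = i ∧ e 1 = j := by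
  have h : i ≠ Equiv.swap 0 i 1 := by
    nth_rewrite 1 [← Equiv.swap_apply_left 0 i]
    exact (Equiv.swap 0 i).injective.ne (by decide)
  refine ⟨(Equiv.swap 0 i).trans (Equiv.swap (Equiv.swap 0 i 1) j), ?_, ?_⟩
  · rw [Equiv.trans_apply, Equiv.swap_apply_left, Equiv.swap_apply_of_ne_of_ne h hij]
  · rw [Equiv.trans_apply, Equiv.swap_apply_left]

/-- The projective curve `p_a = p_b = 0` has no singular points. -/
theorem eq_zero_of_singular (ha : 0 < a) (hab : a < b) (h2 : padicValNat 2 a ≠ padicValNat 2 b)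
    (h3 : a ≠ 1 → padicValNat 3 (b - a) ≤ padicValNat 3 a) {v : Fin 4 → ℂ}
    (hva : ∑ i, v i ^ a = 0)
    (hJ : ∀ i j, i ≠ j → v i ^ (a - 1) * v j ^ (b - 1) - v i ^ (b - 1) * v j ^ (a - 1) = 0) :
    v = 0 := by
  by_contra hv
  obtain ⟨m, hm⟩ := Function.ne_iff.mp hv
  rw [Pi.zero_apply] at hm
  have hd : b - a ≠ 0 := by omega
  have good : ∀ i, i ≠ m → (v i / v m) ^ a = 0 ∧ a ≠ 1 ∨
      starRingEnd ℂ ((v i / v m) ^ a) * (v i / v m) ^ a = 1 ∧ 1 + (v i / v m) ^ a ≠ 0 ∧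
        (a ≠ 1 → 1 + (v i / v m) ^ a + ((v i / v m) ^ a) ^ 2 ≠ 0) := by
    intro i him
    have h := hJ m i him.symm
    rw [show b - 1 = (a - 1) + (b - a) by omega, pow_add, pow_add] at h
    have h' : v m ^ (a - 1) * (v i ^ (a - 1) * (v i ^ (b - a) - v m ^ (b - a))) = 0 := by
      linear_combination h
    rcases mul_eq_zero.mp ((mul_eq_zero.mp h').resolve_left (pow_ne_zero _ hm)) with h0 | h0
    · left
      -- For `a = 1` the factor `v i ^ (a - 1)` is 1, so zero coordinates are ruled out; this is why
      -- cube roots of unity matter only for `a ≠ 1`.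
      have h1 : a - 1 ≠ 0 := fun h1 => by simp [h1] at h0
      rw [pow_eq_zero_iff h1] at h0
      exact ⟨by simp [h0, ha.ne'], by omega⟩
    · right
      have hz : (v i / v m) ^ (b - a) = 1 := by
        rw [div_pow, sub_eq_zero.mp h0, div_self (pow_ne_zero _ hm)]
      refine ⟨?_, one_add_pow_ne_zero ha hab h2 hz,
        fun h1 => one_add_pow_add_sq_ne_zero hab (h3 h1) hz⟩
      have hn : ‖v i / v m‖ = 1 := Complex.norm_eq_one_of_pow_eq_one hz hd
      rw [← Complex.normSq_eq_conj_mul_self, Complex.normSq_eq_norm_sq, norm_pow, hn]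
      simp
  have he0 : Equiv.swap 0 m 0 = m := Equiv.swap_apply_left 0 m
  have hne : ∀ i : Fin 4, i ≠ 0 → Equiv.swap 0 m i ≠ m := fun i hi h =>
    hi ((Equiv.swap 0 m).injective (h.trans he0.symm))
  refine one_add_add_add_ne_zero (good _ (hne 1 (by decide))) (good _ (hne 2 (by decide)))
    (good _ (hne 3 (by decide))) ?_
  rw [sum_perm (Equiv.swap 0 m), he0] at hva
  have hma : v m ^ a ≠ 0 := pow_ne_zero _ hm
  simp only [div_pow]
  field_simp
  linear_combination hva

theorem exists_x_pow_mem (ha : 0 < a) (hab : a < b) (h2 : padicValNat 2 a ≠ padicValNat 2 b)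
    (h3 : a ≠ 1 → padicValNat 3 (b - a) ≤ padicValNat 3 a) {K : Ideal (PowerSumRing a b)}
    (hK : ∀ i j, i ≠ j → ∃ N, minor a b i j ^ N ∈ K) (k : Fin 4) : ∃ N, x a b k ^ N ∈ K := by
  set K' := K.comap (Ideal.Quotient.mk (powerSumIdeal a b)) with hK'
  have hX : X k ∈ K'.radical := by
    rw [← vanishingIdeal_zeroLocus_eq_radical (K := ℂ), mem_vanishingIdeal_iff]
    intro v hv
    rw [mem_zeroLocus_iff] at hv
    have hva : aeval v (psum (Fin 4) ℂ a) = 0 := hv _ (by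
      rw [hK', Ideal.mem_comap, mk_psum_left]; exact K.zero_mem)
    have hv0 : v = 0 := by
      refine eq_zero_of_singular ha hab h2 h3 (by simpa [psum] using hva) fun i j hij => ?_
      obtain ⟨N, hN⟩ := hK i j hij
      have := hv ((X i ^ (a - 1) * X j ^ (b - 1) - X i ^ (b - 1) * X j ^ (a - 1)) ^ N) (by
        rw [hK', Ideal.mem_comap]
        simpa [minor, x] using hN)
      rw [map_pow] at this
      simpa using IsNilpotent.eq_zero ⟨N, this⟩
    simp [hv0]
  obtain ⟨N, hN⟩ := hX
  exact ⟨N, by simpa [hK', x] using hN⟩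

/-- The grading `x_i ↦ x_i T` sends an idempotent to an idempotent polynomial over a reduced ring,
which is constant in `T`. Comparing `T = 1` with `T = 0` shows that it is a scalar. -/
theorem eq_zero_or_one_of_isIdempotentElem [IsReduced (PowerSumRing a b)] (ha : 0 < a) (hb : 0 < b)
    {w : PowerSumRing a b} (hw : IsIdempotentElem w) : w = 0 ∨ w = 1 := by
  let τ : PowerSumRing a b →+* Polynomial (PowerSumRing a b) :=
    lift (Polynomial.C.comp (algebraMap ℂ _)) (fun i => Polynomial.C (x a b i) * Polynomial.X)
      (Polynomial.sum_C_mul_X_pow_eq_zero sum_x_pow_left)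
      (Polynomial.sum_C_mul_X_pow_eq_zero sum_x_pow_right)
  let ε : PowerSumRing a b →+* ℂ :=
    lift (RingHom.id ℂ) (fun _ => 0) (by simp [ha.ne']) (by simp [hb.ne'])
  have τx : ∀ i, τ (x a b i) = Polynomial.C (x a b i) * Polynomial.X := lift_x _ _ _ _
  have τC : ∀ c, τ (algebraMap ℂ _ c) = Polynomial.C (algebraMap ℂ _ c) := lift_algebraMap _ _ _ _
  have εx : ∀ i, ε (x a b i) = 0 := lift_x _ _ _ _
  have εC : ∀ c, ε (algebraMap ℂ _ c) = c := lift_algebraMap _ _ _ _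
  have h1 : (Polynomial.evalRingHom 1).comp τ = RingHom.id _ := by
    refine ringHom_ext (fun c => ?_) fun i => ?_
    · rw [RingHom.comp_apply, τC, Polynomial.coe_evalRingHom, Polynomial.eval_C, RingHom.id_apply]
    · rw [RingHom.comp_apply, τx, Polynomial.coe_evalRingHom, Polynomial.eval_mul_X,
        Polynomial.eval_C, mul_one, RingHom.id_apply]
  have h0 : (Polynomial.evalRingHom 0).comp τ = (algebraMap ℂ _).comp ε := by
    refine ringHom_ext (fun c => ?_) fun i => ?_
    · rw [RingHom.comp_apply, τC, Polynomial.coe_evalRingHom, Polynomial.eval_C,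
        RingHom.comp_apply, εC]
    · rw [RingHom.comp_apply, τx, Polynomial.coe_evalRingHom, Polynomial.eval_mul_X,
        mul_zero, RingHom.comp_apply, εx, map_zero]
  have e0 : w = algebraMap ℂ _ (ε w) :=
    Polynomial.eq_of_isIdempotentElem_of_eval h1 hw (DFunLike.congr_fun h0 w)
  rcases IsIdempotentElem.iff_eq_zero_or_one.mp (hw.map ε) with h | h
  · left; rw [e0, h, map_zero]
  · right; rw [e0, h, map_one]

section

variable (ha : 0 < a) (hab : a < b) (h2 : padicValNat 2 a ≠ padicValNat 2 b)
include ha hab h2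

theorem isReduced_of_padicValNat_two_ne : IsReduced (PowerSumRing a b) := by
  let e : Equiv.Perm (Fin 4) := 1
  let := (baseMap a b e).toAlgebra
  have := etale_away_minor ha (ha.trans hab) e
  exact isReduced_of_etale_away (MvPolynomial (Fin 2) ℂ)
    (fun r hr => eq_zero_of_minor_mul_eq_zero ha hab h2 e hr)

theorem exists_idempotent_fraction {i j : Fin 4} (hij : i ≠ j) (f : PowerSumRing a b) :
    ∃ (N : ℕ) (y : PowerSumRing a b), y * f = minor a b i j ^ N * f ∧
      ∀ z, z * f = 0 → y * z = 0 := by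
  obtain ⟨e, rfl, rfl⟩ := exists_perm hij
  let := (baseMap a b e).toAlgebra
  have := etale_away_minor ha (ha.trans hab) e
  exact exists_idempotent_fraction_of_etale_away (MvPolynomial (Fin 2) ℂ)
    (fun r hr => eq_zero_of_minor_mul_eq_zero ha hab h2 e hr) f

theorem exists_minor_pow_mul_eq_of_isIntegral [IsDomain (PowerSumRing a b)] {i j : Fin 4}
    (hij : i ≠ j) {p q : PowerSumRing a b} (hq : q ≠ 0)
    (hpq : IsIntegral (PowerSumRing a b)
      (algebraMap _ (FractionRing (PowerSumRing a b)) p / algebraMap _ _ q)) :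
    ∃ (N : ℕ) (y : PowerSumRing a b), minor a b i j ^ N * p = q * y := by
  obtain ⟨e, rfl, rfl⟩ := exists_perm hij
  let := (baseMap a b e).toAlgebra
  have := etale_away_minor ha (ha.trans hab) e
  refine exists_pow_mul_eq_of_isIntegral_of_etale_away (MvPolynomial (Fin 2) ℂ)
    (fun h => ?_) hq hpq
  exact one_ne_zero (eq_zero_of_minor_mul_eq_zero ha hab h2 e (r := 1) (by rw [h, zero_mul]))

theorem isDomain_of_padicValNat (h3 : a ≠ 1 → padicValNat 3 (b - a) ≤ padicValNat 3 a) :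
    IsDomain (PowerSumRing a b) := by
  have hred := isReduced_of_padicValNat_two_ne ha hab h2
  have hb := ha.trans hab
  have : Nontrivial (PowerSumRing a b) :=
    (lift (RingHom.id ℂ) (fun _ => 0) (by simp [ha.ne']) (by simp [hb.ne']) :
      PowerSumRing a b →+* ℂ).domain_nontrivial
  have : NoZeroDivisors (PowerSumRing a b) := by
    refine ⟨fun {f g} hfg => ?_⟩
    by_contra! hne
    obtain ⟨hf, hg⟩ := hne
    -- `I₂` is the annihilator of `f` and `I₁` the annihilator of `I₂`. Their sum contains powers of
    -- all minors, hence of all variables.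
    let I₂ : Ideal (PowerSumRing a b) := LinearMap.ker (LinearMap.mulRight _ f)
    have mem₂ : ∀ z, z ∈ I₂ ↔ z * f = 0 := fun z => by simp [I₂]
    let I₁ : Ideal (PowerSumRing a b) := ⨅ z : I₂, LinearMap.ker (LinearMap.mulRight _ (z : PowerSumRing a b))
    have mem₁ : ∀ y, y ∈ I₁ ↔ ∀ z, z * f = 0 → y * z = 0 := fun y => by
      simp [I₁, mem₂]
    have hK : ∀ k, ∃ N, x a b k ^ N ∈ I₁ ⊔ I₂ := by
      refine exists_x_pow_mem ha hab h2 h3 fun i j hij => ?_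
      obtain ⟨N, y, hy, hy'⟩ := exists_idempotent_fraction ha hab h2 hij f
      refine ⟨N, Submodule.mem_sup.mpr ⟨y, (mem₁ y).mpr hy', minor a b i j ^ N - y,
        (mem₂ _).mpr ?_, by ring⟩⟩
      linear_combination -hy
    obtain ⟨m, hm⟩ := hK 0
    obtain ⟨n, hn⟩ := hK 1
    obtain ⟨y₀, hy₀, z₀, hz₀, h0⟩ := Submodule.mem_sup.mp hm
    obtain ⟨y₁, hy₁, z₁, hz₁, h1⟩ := Submodule.mem_sup.mp hn
    have hyz : ∀ y ∈ I₁, ∀ z ∈ I₂, y * z = 0 := fun y hy z hz =>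
      (mem₁ y).mp hy z ((mem₂ z).mp hz)
    -- The fractions `y₀ / x₀^m` and `y₁ / x₁^n` agree because `I₁ * I₂ = 0`; the regular sequence
    -- turns their common value into the element `w`, which is idempotent.
    obtain ⟨w, hw⟩ := exists_eq_x_pow_mul_of_x_pow_mul_eq ha hab h2 1 n m
      (r := y₀) (s := y₁) (by
        rw [Equiv.Perm.one_apply, Equiv.Perm.one_apply, ← h0, ← h1]
        linear_combination hyz _ hy₀ _ hz₁ - hyz _ hy₁ _ hz₀)
    rw [Equiv.Perm.one_apply] at hw
    have cancel : ∀ r, x a b 0 ^ m * r = 0 → r = 0 := fun r hr =>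
      eq_zero_of_x_pow_mul_eq_zero ha hab 1 m hr
    have hz₀' : z₀ = x a b 0 ^ m * (1 - w) := by rw [mul_sub, ← hw, ← h0]; ring
    have hidem : IsIdempotentElem w := by
      have : w * (1 - w) = 0 := cancel _ (cancel _ (by
        have := hyz _ hy₀ _ hz₀
        rw [hw, hz₀'] at this
        linear_combination this))
      rw [IsIdempotentElem]
      linear_combination -this
    rcases eq_zero_or_one_of_isIdempotentElem ha hb hidem with rfl | rfl
    · apply hf
      rw [sub_zero, mul_one] at hz₀'
      rw [mem₂, hz₀'] at hz₀
      exact cancel _ hz₀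
    · apply hg
      rw [mul_one] at hw
      rw [mem₁, hw] at hy₀
      exact cancel _ (hy₀ g (by rw [mul_comm]; exact hfg))
  exact NoZeroDivisors.to_isDomain _

theorem isNormalDomain_of_padicValNat (h3 : a ≠ 1 → padicValNat 3 (b - a) ≤ padicValNat 3 a) :
    IsNormalDomain (PowerSumRing a b) := by
  have hdom := isDomain_of_padicValNat ha hab h2 h3
  refine ⟨hdom, (isIntegrallyClosed_iff (FractionRing (PowerSumRing a b))).mpr ?_⟩
  intro r hr
  obtain ⟨p, q, hq, rfl⟩ := IsFractionRing.div_surjective (A := PowerSumRing a b) r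
  have hq := nonZeroDivisors.ne_zero hq
  -- The ideal of denominators of `p / q`.
  let K : Ideal (PowerSumRing a b) := Submodule.comap (LinearMap.mulRight _ p) (Ideal.span {q})
  have memK : ∀ h, h ∈ K ↔ q ∣ h * p := fun h => by
    simp [K, Ideal.mem_span_singleton]
  have hK : ∀ k, ∃ N, x a b k ^ N ∈ K := by
    refine exists_x_pow_mem ha hab h2 h3 fun i j hij => ?_
    obtain ⟨N, y, hy⟩ := exists_minor_pow_mul_eq_of_isIntegral ha hab h2 hij hq hr
    exact ⟨N, (memK _).mpr ⟨y, hy⟩⟩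
  obtain ⟨m, hm⟩ := hK 0
  obtain ⟨n, hn⟩ := hK 1
  obtain ⟨s, hs⟩ := (memK _).mp hm
  obtain ⟨t, ht⟩ := (memK _).mp hn
  obtain ⟨u, hu⟩ := exists_eq_x_pow_mul_of_x_pow_mul_eq ha hab h2 1 n m (r := s) (s := t) (by
    apply mul_left_cancel₀ hq
    rw [Equiv.Perm.one_apply, Equiv.Perm.one_apply]
    linear_combination x a b 0 ^ m * ht - x a b 1 ^ n * hs)
  rw [Equiv.Perm.one_apply] at hu
  have hp : p = q * u := by
    rw [← sub_eq_zero]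
    apply eq_zero_of_x_pow_mul_eq_zero ha hab 1 m
    rw [Equiv.Perm.one_apply]
    linear_combination hs + q * hu
  refine ⟨u, ?_⟩
  rw [hp, map_mul, mul_div_cancel_left₀]
  simpa using hq

end

end PowerSumRing

/-! ### Zero divisors when the 2-adic valuations agree -/

theorem odd_of_eq_two_pow_padicValNat_mul {a s : ℕ} (ha : a ≠ 0) (h : a = 2 ^ padicValNat 2 a * s) :
    Odd s := by
  rw [← Nat.not_even_iff_odd, even_iff_two_dvd]
  intro hs
  apply pow_succ_padicValNat_not_dvd (p := 2) ha
  nth_rewrite 2 [h]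
  rw [pow_succ]
  exact mul_dvd_mul_left _ hs

theorem Odd.pow_add_pow_eq_geom_sum_mul {R : Type*} [CommRing R] {n : ℕ} (hn : Odd n) (u v : R) :
    u ^ n + v ^ n = (∑ i ∈ Finset.range n, u ^ i * (-v) ^ (n - 1 - i)) * (u + v) := by
  have := geom_sum₂_mul u (-v) n
  rw [sub_neg_eq_add, hn.neg_pow, sub_neg_eq_add] at this
  exact this.symm

namespace PowerSumRing

variable {a b : ℕ}

/-- With `a = q s`, `b = q t` and `s, t` odd, the elements `u i = x i ^ q` satisfy two relations
that are linear in `u 0 + u 1` and `u 2 + u 3`. The determinant of this system kills `u 0 + u 1`,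
and each factor is nonzero at a suitable point. -/
theorem not_isDomain_of_padicValNat_two_eq (ha : 0 < a) (hab : a < b)
    (h2 : padicValNat 2 a = padicValNat 2 b) : ¬ IsDomain (PowerSumRing a b) := by
  intro hdom
  obtain ⟨s, hs⟩ : 2 ^ padicValNat 2 a ∣ a := pow_padicValNat_dvd
  obtain ⟨t, ht⟩ : 2 ^ padicValNat 2 b ∣ b := pow_padicValNat_dvd
  have hs' := odd_of_eq_two_pow_padicValNat_mul ha.ne' hs
  have ht' := odd_of_eq_two_pow_padicValNat_mul (ha.trans hab).ne' ht
  rw [← h2] at ht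
  set q := 2 ^ padicValNat 2 a with hq
  have hq0 : 0 < q := by positivity
  have hst : s ≠ t := by rintro rfl; omega
  have hroot : ∀ c : ℂ, ∃ y : ℂ, y ^ q = c := fun c => IsAlgClosed.exists_pow_nat_eq c hq0
  choose ρ hρ using hroot
  have hsum : ∀ c d : ℂ, ∀ n r, Odd r → n = q * r →
      ∑ i, ![ρ c, ρ (-c), ρ d, ρ (-d)] i ^ n = 0 := by
    intro c d n r hr hn
    rw [Fin.sum_univ_four, hn]
    simp only [pow_mul, Matrix.cons_val_zero, Matrix.cons_val_one, Matrix.cons_val, hρ,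
      hr.neg_pow]
    ring
  let G : ℕ → PowerSumRing a b → PowerSumRing a b → PowerSumRing a b := fun n u v =>
    ∑ i ∈ Finset.range n, u ^ i * (-v) ^ (n - 1 - i)
  let u : Fin 4 → PowerSumRing a b := fun i => x a b i ^ q
  have hrel : ∀ n r, Odd r → n = q * r → ∑ i, x a b i ^ n = 0 →
      G r (u 0) (u 1) * (u 0 + u 1) + G r (u 2) (u 3) * (u 2 + u 3) = 0 := by
    intro n r hr hn h
    rw [← hr.pow_add_pow_eq_geom_sum_mul, ← hr.pow_add_pow_eq_geom_sum_mul, ← h,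
      Fin.sum_univ_four, hn]
    simp only [pow_mul, u]
    ring
  have h1 := hrel a s hs' hs sum_x_pow_left
  have h2 := hrel b t ht' ht sum_x_pow_right
  have hzero : (G s (u 0) (u 1) * G t (u 2) (u 3) - G t (u 0) (u 1) * G s (u 2) (u 3)) *
      (u 0 + u 1) = 0 := by
    linear_combination G t (u 2) (u 3) * h1 - G s (u 2) (u 3) * h2
  rcases mul_eq_zero.mp hzero with h | h
  -- At `u = (1, -1, 2, -2)` the determinant is `s t (2 ^ (t - 1) - 2 ^ (s - 1))`, nonzero because
  -- `s ≠ t`.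
  · let φ : PowerSumRing a b →+* ℂ := lift (RingHom.id ℂ) ![ρ 1, ρ (-1), ρ 2, ρ (-2)]
      (hsum 1 2 a s hs' hs) (hsum 1 2 b t ht' ht)
    have φu : ∀ i, φ (u i) = ![ρ 1, ρ (-1), ρ 2, ρ (-2)] i ^ q := fun i => by
      simp only [u, map_pow]; rw [lift_x]
    have φ0 : φ (u 0) = 1 := by rw [φu]; exact hρ 1
    have φ1 : φ (u 1) = -1 := by rw [φu]; exact hρ (-1)
    have φ2 : φ (u 2) = 2 := by rw [φu]; exact hρ 2
    have φ3 : φ (u 3) = -2 := by rw [φu]; exact hρ (-2)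
    have φG : ∀ n, ∀ v w, ∀ c : ℂ, φ v = c → φ w = -c → φ (G n v w) = n * c ^ (n - 1) := by
      intro n v w c hv hw
      simp only [G, map_sum, map_mul, map_pow, map_neg, hv, hw, neg_neg]
      exact geom_sum₂_self c n
    have := congrArg φ h
    rw [map_sub, map_mul, map_mul, map_zero, φG s _ _ 1 φ0 φ1, φG t _ _ 1 φ0 φ1,
      φG s _ _ 2 φ2 φ3, φG t _ _ 2 φ2 φ3, one_pow, one_pow, mul_one, mul_one] at this
    have hs0 : (s : ℂ) ≠ 0 := by exact_mod_cast hs'.pos.ne'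
    have ht0 : (t : ℂ) ≠ 0 := by exact_mod_cast ht'.pos.ne'
    have h3 : (2 : ℂ) ^ (t - 1) = 2 ^ (s - 1) := by
      apply mul_left_cancel₀ (mul_ne_zero hs0 ht0)
      linear_combination this
    have h4 : 2 ^ (t - 1) = 2 ^ (s - 1) := by exact_mod_cast h3
    have h5 := Nat.pow_right_injective le_rfl h4
    have := hs'.pos
    have := ht'.pos
    omega
  · let φ : PowerSumRing a b →+* ℂ := lift (RingHom.id ℂ) ![ρ 1, ρ 1, ρ (-1), ρ (-1)]
      (by
        rw [← hsum 1 1 a s hs' hs, Fin.sum_univ_four, Fin.sum_univ_four]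
        simp; ring)
      (by
        rw [← hsum 1 1 b t ht' ht, Fin.sum_univ_four, Fin.sum_univ_four]
        simp; ring)
    have φu : ∀ i, φ (u i) = ![ρ 1, ρ 1, ρ (-1), ρ (-1)] i ^ q := fun i => by
      simp only [u, map_pow]; rw [lift_x]
    have := congrArg φ h
    rw [map_add, φu, φu, map_zero] at this
    simp [hρ] at this

end PowerSumRing

/-! ### Failure of normality in the 3-adic case -/

/-- Newton's identities modulo the square of the ideal generated by the first two elementary
symmetric functions. -/
theorem exists_pow_add_pow_add_pow_eq {T : Type*} [CommRing T] (φ : T →+* ℂ) {u v w : T}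
    (h1 : φ (u + v + w) = 0) (h2 : φ (u * v + u * w + v * w) = 0) (h3 : φ (u * v * w) = 1) (i : ℕ) :
    φ (u ^ (3 * i) + v ^ (3 * i) + w ^ (3 * i)) = 3 ∧
    (∃ A B, u ^ (3 * i + 1) + v ^ (3 * i + 1) + w ^ (3 * i + 1) =
      A * (u + v + w) + B * (u * v + u * w + v * w) ^ 2 ∧
      φ A = 3 * i + 1 ∧ φ B = i * (3 * i + 1) / 2) ∧
    ∃ A B, u ^ (3 * i + 2) + v ^ (3 * i + 2) + w ^ (3 * i + 2) =
      A * (u * v + u * w + v * w) + B * (u + v + w) ^ 2 ∧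
      φ A = -(3 * i + 2) ∧ φ B = (i + 1) * (3 * i + 2) / 2 := by
  set e₁ := u + v + w with he₁
  set e₂ := u * v + u * w + v * w with he₂
  set e₃ := u * v * w with he₃
  have recurrence : ∀ n, u ^ (n + 3) + v ^ (n + 3) + w ^ (n + 3) =
      e₁ * (u ^ (n + 2) + v ^ (n + 2) + w ^ (n + 2)) -
      e₂ * (u ^ (n + 1) + v ^ (n + 1) + w ^ (n + 1)) + e₃ * (u ^ n + v ^ n + w ^ n) := fun n => by
    rw [he₁, he₂, he₃]; ring
  induction i with
  | zero =>
    refine ⟨by norm_num; exact map_ofNat φ 3, ⟨1, 0, by rw [he₁]; ring, by simp, by simp⟩,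
      -2, 1, by rw [he₁, he₂]; ring, by simp; exact map_ofNat φ 2, by simp⟩
  | succ i ih =>
    obtain ⟨ih0, ⟨A, B, hAB, hA, hB⟩, C, D, hCD, hC, hD⟩ := ih
    have r0 := recurrence (3 * i)
    have r1 := recurrence (3 * i + 1)
    have r2 := recurrence (3 * i + 2)
    simp only [add_assoc, Nat.reduceAdd] at r0 r1 r2
    have x0 : 3 * (i + 1) = 3 * i + 3 := by ring
    have x1 : 3 * (i + 1) + 1 = 3 * i + 4 := by ring
    have x2 : 3 * (i + 1) + 2 = 3 * i + 5 := by ring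
    rw [x1, x2, x0]
    set P3 := u ^ (3 * i + 3) + (v ^ (3 * i + 3) + w ^ (3 * i + 3)) with hP3
    have hP3' : φ P3 = 3 := by
      rw [r0, map_add, map_sub, map_mul, map_mul, map_mul, h1, h2, h3, ← add_assoc (u ^ (3 * i)),
        ih0]
      ring
    simp only [add_assoc] at hAB hCD ⊢
    rw [← hP3]
    -- Mixed terms in `e₁ e₂` are absorbed into the coefficients, where `φ` annihilates them.
    refine ⟨hP3', ⟨P3 - D * e₁ * e₂ + e₃ * A, -C + e₃ * B, ?_, ?_, ?_⟩,
      e₁ * (-C + e₃ * B) * e₂ - P3 + e₃ * C, P3 - D * e₁ * e₂ + e₃ * A + e₃ * D, ?_, ?_, ?_⟩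
    · rw [r1, hCD, hAB]; ring
    · simp only [map_add, map_sub, map_mul, h1, h2, h3, hP3', hA]; push_cast; ring
    · simp only [map_add, map_neg, map_mul, h3, hC, hB]; push_cast; ring
    · rw [r2, r1, hCD, hAB]; ring
    · simp only [map_add, map_sub, map_mul, h1, h2, h3, hP3', hC]; push_cast; ring
    · simp only [map_add, map_sub, map_mul, h1, h2, h3, hP3', hA, hD]; push_cast; ring

/-- The fraction `α f / g` has square `-α γ`, so it is integral. Were it in `R`, `α f` would be a
multiple of `g`, but the tangent vector `ψ` kills `g` and not `α f`. -/
theorem not_isNormalDomain_of_quadratic_relation {R : Type*} [CommRing R] {f g α γ : R}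
    (h : α * f ^ 2 + γ * g ^ 2 = 0) (hg : g ≠ 0) (ψ : R →+* DualNumber ℂ)
    (hα : TrivSqZeroExt.fst (ψ α) ≠ 0) (hψg : ψ g = 0)
    (hψf : TrivSqZeroExt.fst (ψ f) = 0) (hψf' : TrivSqZeroExt.snd (ψ f) ≠ 0) :
    ¬ IsNormalDomain R := by
  rintro ⟨_, hint⟩
  have hg' : algebraMap R (FractionRing R) g ≠ 0 := by simpa using hg
  have h' : algebraMap R (FractionRing R) α * algebraMap R _ f ^ 2 +
      algebraMap R _ γ * algebraMap R _ g ^ 2 = 0 := by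
    rw [← map_pow, ← map_pow, ← map_mul, ← map_mul, ← map_add, h, map_zero]
  obtain ⟨r, hr⟩ := (isIntegrallyClosed_iff (FractionRing R)).mp hint
    (x := algebraMap R _ (α * f) / algebraMap R _ g) (by
      refine IsIntegral.of_pow (n := 2) (by norm_num) ?_
      have : (algebraMap R (FractionRing R) (α * f) / algebraMap R _ g) ^ 2 =
          algebraMap R _ (-(α * γ)) := by
        rw [div_pow, div_eq_iff (pow_ne_zero _ hg')]
        simp only [map_mul, map_neg]
        linear_combination (algebraMap R (FractionRing R) α) * h'
      rw [this]
      exact isIntegral_algebraMap)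
  rw [eq_div_iff hg', ← map_mul] at hr
  have hr' := IsFractionRing.injective R (FractionRing R) hr
  have h0 : ψ α * ψ f = 0 := by rw [← map_mul, ← hr', map_mul, hψg, mul_zero]
  have := congrArg TrivSqZeroExt.snd h0
  simp [hψf, hα, hψf'] at this

theorem DualNumber.exists_pow_eq {q : ℕ} (hq0 : 0 < q) {z : DualNumber ℂ}
    (hz : TrivSqZeroExt.fst z ≠ 0) : ∃ y, y ^ q = z := by
  obtain ⟨c, hc⟩ := IsAlgClosed.exists_pow_nat_eq (TrivSqZeroExt.fst z) hq0
  have hc0 : c ≠ 0 := by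
    rintro rfl
    rw [zero_pow hq0.ne'] at hc
    exact hz hc.symm
  have hq' : (q : ℂ) ≠ 0 := by exact_mod_cast hq0.ne'
  have hc' := pow_ne_zero (q - 1) hc0
  set κ := algebraMap ℂ (DualNumber ℂ)
  set d := TrivSqZeroExt.snd z / (q * c ^ (q - 1)) with hd
  have hsq : κ d * DualNumber.eps * (κ d * DualNumber.eps) = 0 := by
    linear_combination κ d * κ d * DualNumber.eps_mul_eps (R := ℂ)
  refine ⟨κ c + κ d * DualNumber.eps, ?_⟩
  have hq : (q : DualNumber ℂ) * κ c ^ (q - 1) * κ d = κ (TrivSqZeroExt.snd z) := by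
    rw [← map_natCast κ, ← map_pow, ← map_mul, ← map_mul]
    congr 1
    rw [hd]
    field_simp
  rw [add_pow_of_mul_self_eq_zero _ _ hsq hq0, ← mul_assoc, hq, ← map_pow, hc]
  ext <;> simp [κ, TrivSqZeroExt.algebraMap_eq_inl]

namespace PowerSumRing

/-- Units of the dual numbers have `q`-th roots, so a tangent vector can be prescribed on the powers
`x i ^ q` of the first three variables. -/
theorem exists_hom_dualNumber {q s t : ℕ} (hq : 0 < q) {U V W z : DualNumber ℂ}
    (hU : TrivSqZeroExt.fst U ≠ 0) (hV : TrivSqZeroExt.fst V ≠ 0) (hW : TrivSqZeroExt.fst W ≠ 0)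
    (hs : U ^ s + V ^ s + W ^ s = 0) (ht : U ^ t + V ^ t + W ^ t = 0) (hzs : z ^ (q * s) = 0)
    (hzt : z ^ (q * t) = 0) :
    ∃ ψ : PowerSumRing (q * s) (q * t) →+* DualNumber ℂ, ψ (x _ _ 0 ^ q) = U ∧
      ψ (x _ _ 1 ^ q) = V ∧ ψ (x _ _ 2 ^ q) = W ∧ ψ (x _ _ 3) = z := by
  obtain ⟨u, rfl⟩ := DualNumber.exists_pow_eq hq hU
  obtain ⟨v, rfl⟩ := DualNumber.exists_pow_eq hq hV
  obtain ⟨w, rfl⟩ := DualNumber.exists_pow_eq hq hW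
  refine ⟨lift (algebraMap ℂ _) ![u, v, w, z] ?_ ?_, ?_, ?_, ?_, ?_⟩
  · simp [Fin.sum_univ_four, pow_mul] at hs hzs ⊢
    rw [hs, hzs, add_zero]
  · simp [Fin.sum_univ_four, pow_mul] at ht hzt ⊢
    rw [ht, hzt, add_zero]
  · rw [map_pow, lift_x]; rfl
  · rw [map_pow, lift_x]; rfl
  · rw [map_pow, lift_x]; rfl
  · rw [lift_x]; rfl

/-- The case `3 ∤ s`, `s ≡ t mod 3`, where the curve `p_a = p_b = 0` is singular at points with
exactly three nonzero coordinates. -/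
theorem not_isNormalDomain_of_modEq_three {q s t : ℕ} (hq : 0 < q) (hqs : 1 < q * s) (hst : s < t)
    (hmod : s ≡ t [MOD 3]) (hs3 : ¬ 3 ∣ s) : ¬ IsNormalDomain (PowerSumRing (q * s) (q * t)) := by
  obtain ⟨ω, hω⟩ : ∃ ω : ℂ, IsPrimitiveRoot ω 3 := ⟨_, Complex.isPrimitiveRoot_exp 3 (by norm_num)⟩
  have hω0 : ω ≠ 0 := hω.ne_zero (by norm_num)
  have hΩ : ω ^ 2 + ω + 1 = 0 := by
    have h : (ω - 1) * (ω ^ 2 + ω + 1) = 0 := by linear_combination hω.pow_eq_one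
    exact (mul_eq_zero.mp h).resolve_left (sub_ne_zero.mpr (hω.ne_one (by norm_num)))
  have hqt : 1 < q * t := hqs.trans (Nat.mul_lt_mul_of_pos_left hst hq)
  set κ := algebraMap ℂ (DualNumber ℂ) with hκ
  set fstHom : DualNumber ℂ →+* ℂ := (TrivSqZeroExt.fstHom ℂ ℂ ℂ).toRingHom with hfst
  have fst_apply : ∀ z, fstHom z = TrivSqZeroExt.fst z := fun z => rfl
  set ε : DualNumber ℂ := DualNumber.eps with hε
  have hεε : ε * ε = 0 := DualNumber.eps_mul_eps
  have hκΩ : κ ω ^ 2 + κ ω + 1 = 0 := by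
    rw [← map_pow, ← map_add, ← map_one κ, ← map_add, hΩ, map_zero]
  have fκ : ∀ c, fstHom (κ c) = c := fun c => rfl
  have fε : fstHom ε = 0 := rfl
  have fst_three : TrivSqZeroExt.fst (3 : DualNumber ℂ) = 3 := map_ofNat fstHom 3
  have hfω : TrivSqZeroExt.fst (κ ω) ≠ 0 := hω0
  -- the powers of the roots of unity of order three
  have vanish : ∀ n, ¬ 3 ∣ n → (1 : ℂ) ^ n + ω ^ n + (ω ^ 2) ^ n = 0 := by
    intro n hn
    have h3 : (ω ^ n - 1) * (1 ^ n + ω ^ n + (ω ^ 2) ^ n) = 0 := by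
      have : (ω ^ n) ^ 3 = 1 := by rw [← pow_mul, mul_comm, pow_mul, hω.pow_eq_one, one_pow]
      rw [one_pow, ← pow_mul, mul_comm 2 n, pow_mul]
      linear_combination this
    refine (mul_eq_zero.mp h3).resolve_left fun h => hn ?_
    exact hω.dvd_of_pow_eq_one n (sub_eq_zero.mp h)
  have ht3 : ¬ 3 ∣ t := fun h => hs3 ((hmod.dvd_iff dvd_rfl).mpr h)
  -- Because `q * s` and `q * t` exceed 1, moving the last coordinate alone by `ε` preserves both
  -- equations.
  have hx3 : x (q * s) (q * t) 3 ≠ 0 := by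
    have hv : ∀ n, ¬ 3 ∣ n → (1 : DualNumber ℂ) ^ n + κ ω ^ n + κ (ω ^ 2) ^ n = 0 := fun n hn => by
      rw [← map_one κ, ← map_pow, ← map_pow, ← map_pow, ← map_add, ← map_add, vanish n hn,
        map_zero]
    have hεn : ∀ n, 1 < n → ε ^ n = 0 := fun n hn => by
      obtain ⟨m, rfl⟩ := Nat.exists_eq_add_of_le hn
      rw [pow_add, show Nat.succ 1 = 2 from rfl, sq, hεε, zero_mul]
    obtain ⟨ψ, -, -, -, h3⟩ := exists_hom_dualNumber (s := s) (t := t) hq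
      (U := 1) (V := κ ω) (W := κ (ω ^ 2)) (z := ε) (by simp) hfω
      (by change ω ^ 2 ≠ 0; exact pow_ne_zero 2 hω0) (hv s hs3) (hv t ht3) (hεn _ hqs) (hεn _ hqt)
    intro h0
    rw [h0, map_zero] at h3
    have := congrArg TrivSqZeroExt.snd h3
    simp [hε] at this
  have rel : ∀ n r, n = q * r → ∑ i, x (q * s) (q * t) i ^ n = 0 →
      (x (q * s) (q * t) 0 ^ q) ^ r + (x (q * s) (q * t) 1 ^ q) ^ r +
        (x (q * s) (q * t) 2 ^ q) ^ r + x (q * s) (q * t) 3 ^ n = 0 := by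
    intro n r hn h
    rw [Fin.sum_univ_four] at h
    rw [← pow_mul, ← pow_mul, ← pow_mul, ← hn, h]
  have rels := rel _ s rfl sum_x_pow_left
  have relt := rel _ t rfl sum_x_pow_right
  set g := x (q * s) (q * t) 3 with hg
  set u := x (q * s) (q * t) 0 ^ q with hu
  set v := x (q * s) (q * t) 1 ^ q with hv
  set w := x (q * s) (q * t) 2 ^ q with hw
  have gpow : ∀ n, 1 < n → g ^ n = g ^ (n - 2) * g ^ 2 := fun n hn => by
    rw [← pow_add, Nat.sub_add_cancel hn]
  have hzero : ∀ n, 1 < n → (0 : DualNumber ℂ) ^ n = 0 := fun n hn => zero_pow (by omega)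
  have hi : s = 3 * (s / 3) + s % 3 := (Nat.div_add_mod s 3).symm
  have hj : t = 3 * (t / 3) + t % 3 := (Nat.div_add_mod t 3).symm
  rw [← (show s % 3 = t % 3 from hmod)] at hj
  set i := s / 3
  set j := t / 3
  have hij : i ≠ j := fun h => by rw [h] at hi; omega
  have hij' : (i : ℂ) - j ≠ 0 := sub_ne_zero.mpr (by exact_mod_cast hij)
  have hr : s % 3 = 1 ∨ s % 3 = 2 := by
    have := Nat.mod_lt s (show 3 > 0 by norm_num)
    have : s % 3 ≠ 0 := fun h => hs3 (Nat.dvd_of_mod_eq_zero h)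
    omega
  rcases hr with hr | hr <;> rw [hr] at hi hj
  -- Residue 1: the power sums are linear in `e₁` and quadratic in `e₂`. The direction `(1, ω², ω)`
  -- fixes `e₁ = 0` and moves `e₂` to `-3 ε`.
  · set U : DualNumber ℂ := 1 + ε with hU
    set V : DualNumber ℂ := κ ω + κ ω ^ 2 * ε with hV
    set W : DualNumber ℂ := κ ω ^ 2 + κ ω * ε with hW
    have E1 : U + V + W = 0 := by rw [hU, hV, hW]; linear_combination (1 + ε) * hκΩ
    have E2 : U * V + U * W + V * W = -3 * ε := by
      rw [hU, hV, hW]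
      linear_combination ((1 + 2 * ε + ε * ε) + (κ ω - 1) + ε * (κ ω ^ 2 - κ ω + 1) +
        ε * ε * (κ ω - 1)) * hκΩ
    have E2' : (U * V + U * W + V * W) ^ 2 = 0 := by rw [E2]; linear_combination 9 * hεε
    have f1 : fstHom (U + V + W) = 0 := by rw [E1, map_zero]
    have f2 : fstHom (U * V + U * W + V * W) = 0 := by rw [E2, map_mul, fε, mul_zero]
    have f3 : fstHom (U * V * W) = 1 := by
      simp only [hU, hV, hW, map_add, map_mul, map_pow, map_one, fκ, fε]
      linear_combination hω.pow_eq_one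
    have hvan : ∀ k, U ^ (3 * k + 1) + V ^ (3 * k + 1) + W ^ (3 * k + 1) = 0 := fun k => by
      obtain ⟨-, ⟨A, B, h, -, -⟩, -⟩ := exists_pow_add_pow_add_pow_eq fstHom f1 f2 f3 k
      rw [h, E1, E2', mul_zero, mul_zero, add_zero]
    obtain ⟨ψ, ψu, ψv, ψw, ψg⟩ := exists_hom_dualNumber (s := s) (t := t) hq
      (U := U) (V := V) (W := W) (z := 0)
      (by simp [← fst_apply, hU, fε])
      (by simpa [← fst_apply, hV, fε, fκ] using hω0)
      (by simpa [← fst_apply, hW, fε, fκ] using hω0)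
      (by rw [hi]; exact hvan i) (by rw [hj]; exact hvan j) (hzero _ hqs) (hzero _ hqt)
    rw [← hu] at ψu
    rw [← hv] at ψv
    rw [← hw] at ψw
    have ψ1 : ψ (u + v + w) = U + V + W := by rw [map_add, map_add, ψu, ψv, ψw]
    have ψ2 : ψ (u * v + u * w + v * w) = U * V + U * W + V * W := by
      simp only [map_add, map_mul, ψu, ψv, ψw]
    have ψ3 : ψ (u * v * w) = U * V * W := by simp only [map_mul, ψu, ψv, ψw]
    have φ1 : (fstHom.comp ψ) (u + v + w) = 0 := by rw [RingHom.comp_apply, ψ1, f1]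
    have φ2 : (fstHom.comp ψ) (u * v + u * w + v * w) = 0 := by rw [RingHom.comp_apply, ψ2, f2]
    have φ3 : (fstHom.comp ψ) (u * v * w) = 1 := by rw [RingHom.comp_apply, ψ3, f3]
    obtain ⟨-, ⟨A, B, hAB, hA, hB⟩, -⟩ := exists_pow_add_pow_add_pow_eq _ φ1 φ2 φ3 i
    obtain ⟨-, ⟨A', B', hAB', hA', hB'⟩, -⟩ := exists_pow_add_pow_add_pow_eq _ φ1 φ2 φ3 j
    rw [← hi] at hAB
    rw [← hj] at hAB'
    -- Eliminating `e₁` between the two relations leaves only squares of `e₂` and `g`. The value of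
    -- `α` at the point is `(3i + 1)(3j + 1)(i - j) / 2`.
    refine not_isNormalDomain_of_quadratic_relation (f := u * v + u * w + v * w) (g := g)
      (α := A' * B - A * B') (γ := A' * g ^ (q * s - 2) - A * g ^ (q * t - 2)) ?_ hx3 ψ ?_ ψg
      (by rw [ψ2]; exact f2) (by rw [ψ2, E2]; simp [hε, fst_three])
    · rw [hAB, gpow _ hqs] at rels
      rw [hAB', gpow _ hqt] at relt
      linear_combination A' * rels - A * relt
    · change (fstHom.comp ψ) (A' * B - A * B') ≠ 0
      rw [map_sub, map_mul, map_mul, hA, hB, hA', hB']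
      have : (3 * (j : ℂ) + 1) * (i * (3 * i + 1) / 2) - (3 * i + 1) * (j * (3 * j + 1) / 2) =
          (3 * i + 1) * (3 * j + 1) * (i - j) / 2 := by ring
      rw [this]
      have h1 : (3 * (i : ℂ) + 1) ≠ 0 := by norm_cast
      have h2 : (3 * (j : ℂ) + 1) ≠ 0 := by norm_cast
      exact div_ne_zero (mul_ne_zero (mul_ne_zero h1 h2) hij') two_ne_zero
  -- Residue 2 exchanges the roles of `e₁` and `e₂`: the direction `(1, 1, 1)` fixes `e₂ = 0` and
  -- moves `e₁` to `3 ε`.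
  · set U : DualNumber ℂ := 1 + ε with hU
    set V : DualNumber ℂ := κ ω + ε with hV
    set W : DualNumber ℂ := κ ω ^ 2 + ε with hW
    have E1 : U + V + W = 3 * ε := by rw [hU, hV, hW]; linear_combination hκΩ
    have E2 : U * V + U * W + V * W = 0 := by
      rw [hU, hV, hW]
      linear_combination (κ ω + 2 * ε) * hκΩ + 3 * hεε
    have E1' : (U + V + W) ^ 2 = 0 := by rw [E1]; linear_combination 9 * hεε
    have f1 : fstHom (U + V + W) = 0 := by rw [E1, map_mul, fε, mul_zero]
    have f2 : fstHom (U * V + U * W + V * W) = 0 := by rw [E2, map_zero]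
    have f3 : fstHom (U * V * W) = 1 := by
      simp only [hU, hV, hW, map_add, map_mul, map_pow, map_one, fκ, fε]
      linear_combination hω.pow_eq_one
    have hvan : ∀ k, U ^ (3 * k + 2) + V ^ (3 * k + 2) + W ^ (3 * k + 2) = 0 := fun k => by
      obtain ⟨-, -, A, B, h, -, -⟩ := exists_pow_add_pow_add_pow_eq fstHom f1 f2 f3 k
      rw [h, E2, E1', mul_zero, mul_zero, add_zero]
    obtain ⟨ψ, ψu, ψv, ψw, ψg⟩ := exists_hom_dualNumber (s := s) (t := t) hq
      (U := U) (V := V) (W := W) (z := 0)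
      (by simp [← fst_apply, hU, fε])
      (by simpa [← fst_apply, hV, fε, fκ] using hω0)
      (by simpa [← fst_apply, hW, fε, fκ] using hω0)
      (by rw [hi]; exact hvan i) (by rw [hj]; exact hvan j) (hzero _ hqs) (hzero _ hqt)
    rw [← hu] at ψu
    rw [← hv] at ψv
    rw [← hw] at ψw
    have ψ1 : ψ (u + v + w) = U + V + W := by rw [map_add, map_add, ψu, ψv, ψw]
    have ψ2 : ψ (u * v + u * w + v * w) = U * V + U * W + V * W := by
      simp only [map_add, map_mul, ψu, ψv, ψw]
    have ψ3 : ψ (u * v * w) = U * V * W := by simp only [map_mul, ψu, ψv, ψw]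
    have φ1 : (fstHom.comp ψ) (u + v + w) = 0 := by rw [RingHom.comp_apply, ψ1, f1]
    have φ2 : (fstHom.comp ψ) (u * v + u * w + v * w) = 0 := by rw [RingHom.comp_apply, ψ2, f2]
    have φ3 : (fstHom.comp ψ) (u * v * w) = 1 := by rw [RingHom.comp_apply, ψ3, f3]
    obtain ⟨-, -, A, B, hAB, hA, hB⟩ := exists_pow_add_pow_add_pow_eq _ φ1 φ2 φ3 i
    obtain ⟨-, -, A', B', hAB', hA', hB'⟩ := exists_pow_add_pow_add_pow_eq _ φ1 φ2 φ3 j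
    rw [← hi] at hAB
    rw [← hj] at hAB'
    refine not_isNormalDomain_of_quadratic_relation (f := u + v + w) (g := g)
      (α := A' * B - A * B') (γ := A' * g ^ (q * s - 2) - A * g ^ (q * t - 2)) ?_ hx3 ψ ?_ ψg
      (by rw [ψ1]; exact f1) (by rw [ψ1, E1]; simp [hε, fst_three])
    · rw [hAB, gpow _ hqs] at rels
      rw [hAB', gpow _ hqt] at relt
      linear_combination A' * rels - A * relt
    · change (fstHom.comp ψ) (A' * B - A * B') ≠ 0
      rw [map_sub, map_mul, map_mul, hA, hB, hA', hB']
      have : -(3 * (j : ℂ) + 2) * ((i + 1) * (3 * i + 2) / 2) -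
          -(3 * i + 2) * ((j + 1) * (3 * j + 2) / 2) =
          -((3 * i + 2) * (3 * j + 2) * (i - j) / 2) := by ring
      rw [this]
      have h1 : (3 * (i : ℂ) + 2) ≠ 0 := by norm_cast
      have h2 : (3 * (j : ℂ) + 2) ≠ 0 := by norm_cast
      exact neg_ne_zero.mpr (div_ne_zero (mul_ne_zero (mul_ne_zero h1 h2) hij') two_ne_zero)

theorem not_isNormalDomain_of_padicValNat_three {a b : ℕ} (ha : 1 < a) (hab : a < b)
    (h3 : padicValNat 3 a = padicValNat 3 b) (h3' : padicValNat 3 b ≠ padicValNat 3 (b - a)) :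
    ¬ IsNormalDomain (PowerSumRing a b) := by
  obtain ⟨s, hs⟩ : 3 ^ padicValNat 3 a ∣ a := pow_padicValNat_dvd
  obtain ⟨t, ht⟩ : 3 ^ padicValNat 3 b ∣ b := pow_padicValNat_dvd
  have hs3 : ¬ 3 ∣ s := by
    intro h
    apply pow_succ_padicValNat_not_dvd (p := 3) (n := a) (by omega)
    nth_rewrite 2 [hs]
    rw [pow_succ]
    exact mul_dvd_mul_left _ h
  rw [← h3] at ht h3'
  have hq0 : 0 < 3 ^ padicValNat 3 a := by positivity
  have hst : s < t := by
    rw [hs, ht] at hab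
    exact lt_of_mul_lt_mul_left hab hq0.le
  -- Otherwise `b - a` would have the same 3-adic valuation as `a`.
  have hmod : s ≡ t [MOD 3] := by
    rw [Nat.modEq_iff_dvd' hst.le]
    by_contra hndvd
    apply h3'
    have hsub : b - a = 3 ^ padicValNat 3 a * (t - s) := by rw [Nat.mul_sub, ← ht, ← hs]
    rw [hsub, padicValNat.mul hq0.ne' (by omega), padicValNat.prime_pow,
      padicValNat.eq_zero_of_not_dvd hndvd, add_zero]
  rw [hs] at ha
  generalize 3 ^ padicValNat 3 a = q at *
  subst hs ht
  exact not_isNormalDomain_of_modEq_three hq0 ha hst hmod hs3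

end PowerSumRing

theorem theorem3p1 (a b : ℕ) (ha : 0 < a) (hab : a < b) :
    (a = 1 →
      (IsNormalDomain (MvPolynomial (Fin 4) ℂ ⧸ powerSumIdeal a b) ↔ Even b)) ∧
    (1 < a →
      (IsNormalDomain (MvPolynomial (Fin 4) ℂ ⧸ powerSumIdeal a b) ↔
        padicValNat 2 a ≠ padicValNat 2 b ∧
        (padicValNat 3 a ≠ padicValNat 3 b ∨
          (padicValNat 3 a = padicValNat 3 b ∧
            padicValNat 3 b = padicValInt 3 ((a : ℤ) - (b : ℤ)))))) := by
  have hnot2 : IsNormalDomain (PowerSumRing a b) → padicValNat 2 a ≠ padicValNat 2 b :=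
    fun h h2 => PowerSumRing.not_isDomain_of_padicValNat_two_eq ha hab h2 h.1
  have hval : padicValInt 3 ((a : ℤ) - (b : ℤ)) = padicValNat 3 (b - a) := by
    rw [padicValInt]
    congr 1
    omega
  rw [hval]
  refine ⟨fun ha1 => ⟨fun h => ?_, fun h => ?_⟩, fun ha1 => ⟨fun h => ⟨hnot2 h, ?_⟩, fun h => ?_⟩⟩
  · have h2 := hnot2 h
    by_contra hb
    apply h2
    rw [ha1, padicValNat_one_right, padicValNat.eq_zero_of_not_dvd]
    rwa [← even_iff_two_dvd]
  · refine PowerSumRing.isNormalDomain_of_padicValNat ha hab ?_ fun h1 => absurd ha1 h1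
    rw [ha1, padicValNat_one_right]
    have := one_le_padicValNat_of_dvd (p := 2) (by omega) h.two_dvd
    omega
  · by_contra! h3
    exact PowerSumRing.not_isNormalDomain_of_padicValNat_three ha1 hab h3.1 (h3.2 h3.1) h
  · refine PowerSumRing.isNormalDomain_of_padicValNat ha hab h.1 fun _ => ?_
    -- Both alternatives of condition 2 give ν₃(b - a) ≤ ν₃(a).
    rcases h.2 with h3 | ⟨h3, h3'⟩
    · exact padicValNat_sub_le_of_ne ha hab h3
    · exact (h3'.symm.trans h3.symm).le
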